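/- Let $\mathbb{D}=\{z\in\mathbb{C}:|z|<1\}$. For $\alpha\ge 0$ and $0\le\beta<1$ let $\mathcal{W}_{\mathcal H}^0(\alpha,\beta)$ be the class of harmonic mappings $f=h+\overline{g}$ of $\mathbb{D}$, where $h(z)=z+\sum_{n\ge2}a_nz^n$ and $g(z)=\sum_{n\ge2}b_nz^n$ are analytic in $\mathbb{D}$ and $$\operatorname{Re}\bigl(h'(z)+\alpha zh''(z)-\beta\bigr)>\bigl|g'(z)+\alpha zg''(z)\bigr|\qquad(z\in\mathbb{D}).$$ For $p,q\ge 1$ put $s_{p,q}(f)(z)=\sum_{k=1}^{p}a_kz^k+\overline{\sum_{k=1}^{q}b_kz^k}$, with $a_1=1$, $b_1=0$. A function is called convex in the disk $|z|<R$ if it is injective there and maps $|z|<r$ onto a convex set for every $0<r\le R$. Let $0\le\beta<1$. (i) The equation $$1-4r+(6\beta-2)r^2-8(1-\beta)r^3+(1-2\beta)r^4+4(1-\beta)r^5=0$$ has a smallest root $R_1$ in $(0,1)$, and for every $\alpha\ge0$, every $f\in\mathcal{W}_{\mathcal H}^0(\alpha,\beta)$ and every integer $q>2$, the partial sum $s_{2,q}(f)$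 is convex in the disk $|z|<R_1$. (ii) The equation $$1-4r+(1-\beta)r^2-(8-3\beta)r^3-(5-2\beta)r^4-(4-3\beta)r^5+3(1-\beta)r^6=0$$ has a smallest root $R_2$ in $(0,1)$, and for every $\alpha\ge0$, every $f\in\mathcal{W}_{\mathcal H}^0(\alpha,\beta)$ and every integer $p>2$, the partial sum $s_{p,2}(f)$ is convex in the disk $|z|<R_2$. -/

import Mathlib

open Complex Metric ComplexConjugate

noncomputable section

/-- The canonical pairs `(h, g)` representing the normalised harmonic functions
`f = h + conj g` of the open unit disk with `f 0 = 0`, `f_z 0 = 1`, `f_{conj z} 0 = 0`: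
both parts are holomorphic in the disk, `h = z + ∑_{n ≥ 2} a_n z^n`, `g = ∑_{n ≥ 2} b_n z^n`. -/
structure IsNormalizedHarmonicPair (h g : ℂ → ℂ) : Prop where
  diff_h : DifferentiableOn ℂ h (ball 0 1)
  diff_g : DifferentiableOn ℂ g (ball 0 1)
  h_zero : h 0 = 0
  g_zero : g 0 = 0
  deriv_h_zero : deriv h 0 = 1
  deriv_g_zero : deriv g 0 = 0

/-- The harmonic mapping `f = h + conj g` belongs to the class `W_H^0(α, β)`. -/
structure MemWH (α β : ℝ) (h g : ℂ → ℂ) : Prop extends IsNormalizedHarmonicPair h g where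
  re_gt : ∀ z ∈ ball (0 : ℂ) 1,
    ‖deriv g z + α * z * deriv (deriv g) z‖ <
      (deriv h z + α * z * deriv (deriv h) z - β).re

/-- The `n`-th Taylor coefficient of `h` at the origin. -/
def taylorCoeffZero (h : ℂ → ℂ) (n : ℕ) : ℂ := iteratedDeriv n h 0 / (n.factorial : ℂ)

/-- The section `s_p(h)(z) = ∑_{k=1}^p a_k z^k`. -/
def analyticSection (p : ℕ) (h : ℂ → ℂ) (z : ℂ) : ℂ :=
  ∑ k ∈ Finset.Icc 1 p, taylorCoeffZero h k * z ^ k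

/-- The `(p, q)`-th partial sum `s_p(h) + conj (s_q(g))` of `f = h + conj g`. -/
def harmonicSection (p q : ℕ) (h g : ℂ → ℂ) (z : ℂ) : ℂ :=
  analyticSection p h z + conj (analyticSection q g z)

/-- `F` is convex in the disk `|z| < R`: it is univalent there and maps this disk, as well as
every smaller concentric disk, onto a convex set.  (For harmonic mappings convexity of the
image of a disk does not pass to smaller disks by itself.) -/
structure IsConvexInDisk (F : ℂ → ℂ) (R : ℝ) : Prop where
  univalent : Set.InjOn F (ball 0 R)
  convex_image : ∀ r : ℝ, 0 < r → r ≤ R → Convex ℝ (F '' ball 0 r)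

end

/-! Put `P = (h' - β) / (1 - β)` and `Φ = g' / (1 - β)`. Monotonicity along rays removes `α` from
the hypothesis and leaves `|Φ| ≤ Re P`, with `P 0 = 1` and `Φ 0 = 0` (`MemWH.norm_deriv_lt`).

A harmonic map `H + conj G` is convex once every `f = H + ε G`, `|ε| = 1`, satisfies `|z f''| < Re
(2 f' + z f'')` (`isConvexInDisk_of_norm_lt`): the support line in a given direction sees only one
of these analytic functions. Equivalently, `Re (2 f' + (1 - η) z f'') > 0` whenever `|η| = 1`.

For sections this expression is affine in the Taylor coefficients of `P` and `Φ`, hence a circle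
average of `Re P` and `Φ` against trigonometric polynomials. As `|Φ| ≤ Re P`, it is enough that the
kernel of `Re P` dominates the kernel of `Φ` in modulus (`le_re_section_of_kernel`). Since `Φ 0 =
0`, terms `γ_j (conj u)^j` may be added to the kernel of `Φ` at no cost; a good choice of them makes
the domination hold on a large enough circle.

In (ii), and in (i) when `R₁ ≤ 427/2000`, kernels with margin `κ = 1/50` serve every `β` at once.
For larger `R₁` the margin may be negative, and the term `2β` compensates: the equation for `R₁`
expresses `1 - β` through the radius. -/

/-! ### Circle averages and the kernel method -/

open Real in
theorem circleAverage_dilation_mul_pow {f : ℂ → ℂ} (hf : DifferentiableOn ℂ f (ball 0 1)) {ρ : ℝ}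
    (h0 : 0 ≤ ρ) (h1 : ρ < 1) (k : ℕ) :
    circleAverage (fun w => f (ρ * w) * w ^ k) 0 1 = f 0 * 0 ^ k := by
  have hmaps : ∀ w ∈ closedBall (0 : ℂ) 1, (ρ : ℂ) * w ∈ ball (0 : ℂ) 1 := by
    intro w hw
    rw [mem_closedBall_zero_iff] at hw
    rw [mem_ball_zero_iff, norm_mul, norm_real, Real.norm_of_nonneg h0]
    nlinarith [norm_nonneg w]
  have hd : DifferentiableOn ℂ (fun w => f (ρ * w) * w ^ k) (closedBall 0 1) :=
    (hf.comp (by fun_prop) hmaps).mul (by fun_prop)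
  have hdc : DiffContOnCl ℂ (fun w => f (ρ * w) * w ^ k) (ball 0 |1|) := by
    apply DifferentiableOn.diffContOnCl
    rw [abs_one, closure_ball _ one_ne_zero]
    exact hd
  have := hdc.circleAverage
  simpa using this

-- On the unit circle `conj w = w⁻¹`, so this is Cauchy's formula for the `k`-th coefficient on `|z|
-- = ρ`. That circle degenerates for `ρ = 0`, which is treated separately.
open Real in
theorem circleAverage_dilation_mul_conj_pow {f : ℂ → ℂ} (hf : DifferentiableOn ℂ f (ball 0 1))
    {ρ : ℝ} (h0 : 0 ≤ ρ) (h1 : ρ < 1) (k : ℕ) :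
    circleAverage (fun w => f (ρ * w) * conj w ^ k) 0 1 = ρ ^ k * taylorCoeffZero f k := by
  rcases h0.eq_or_lt with rfl | hρ
  · have h := circleAverage_dilation_mul_pow (f := fun _ => 1) (by fun_prop) le_rfl one_pos k
    have hc := (conjCLE : ℂ →L[ℝ] ℂ).circleAverage_comp_comm (c := 0) (R := 1)
      (f := fun w : ℂ => (1 : ℂ) * w ^ k) (by
        apply ContinuousOn.circleIntegrable'
        fun_prop)
    rw [h] at hc
    have hs := circleAverage_smul (𝕜 := ℂ) (a := f 0) (c := 0) (R := 1)
      (f := ((conjCLE : ℂ →L[ℝ] ℂ) ∘ fun w : ℂ => (1 : ℂ) * w ^ k))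
    rw [hc] at hs
    have he : (fun w : ℂ => f (((0 : ℝ) : ℂ) * w) * conj w ^ k) =
        f 0 • ((conjCLE : ℂ →L[ℝ] ℂ) ∘ fun w : ℂ => (1 : ℂ) * w ^ k) := by
      ext w; simp
    rw [he, hs]
    rcases Nat.eq_zero_or_pos k with rfl | hk
    · simp [taylorCoeffZero]
    · simp [hk.ne']
  have hρ' : (ρ : ℂ) ≠ 0 := by exact_mod_cast hρ.ne'
  have hdc : DiffContOnCl ℂ f (ball 0 ρ) := by
    apply DifferentiableOn.diffContOnCl
    rw [closure_ball _ hρ.ne']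
    exact hf.mono (closedBall_subset_ball h1)
  have hint := DiffContOnCl.circleIntegral_one_div_sub_center_pow_smul hρ k hdc
  have h2 : circleAverage (fun x => x⁻¹ ^ k * f x) 0 ρ = taylorCoeffZero f k := by
    rw [circleAverage_eq_circleIntegral hρ.ne']
    have he : (fun z : ℂ => (z - 0)⁻¹ • (z⁻¹ ^ k * f z)) =
        fun z => (1 / (z - 0) ^ (k + 1)) • f z := by
      ext z
      simp only [smul_eq_mul, sub_zero, one_div, pow_succ, inv_pow, mul_inv]
      ring
    rw [he, hint, taylorCoeffZero, smul_smul, smul_eq_mul]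
    field_simp
  rw [← h2, circleAverage_eq_circleAverage_zero_one (R := ρ), ← smul_eq_mul, ← circleAverage_fun_smul]
  apply circleAverage_congr_sphere
  intro w hw
  have hw1 : ‖w‖ = 1 := by simpa using hw
  have hw0 : w ≠ 0 := by rintro rfl; simp at hw1
  have hcw : conj w = w⁻¹ := by rw [inv_def, normSq_eq_norm_sq, hw1]; simp
  simp only [smul_eq_mul, hcw, add_zero]
  rw [mul_inv, mul_pow, inv_pow, inv_pow]
  field_simp

/-- If `P 0 = 1`, `Φ 0 = 0` and `|Φ| ≤ Re P` in the disk, an inequality between trigonometric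
kernels on the circle `|u| = r` yields a lower bound for sections of `P` and `Φ` in `|z| < r`. -/
theorem le_re_section_of_kernel {P Φ : ℂ → ℂ} (hP : DifferentiableOn ℂ P (ball 0 1))
    (hΦ : DifferentiableOn ℂ Φ (ball 0 1)) (hP0 : P 0 = 1) (hΦ0 : Φ 0 = 0)
    (hle : ∀ z ∈ ball (0 : ℂ) 1, ‖Φ z‖ ≤ (P z).re)
    {n m l : ℕ} {c γ : ℕ → ℂ} {a κ r : ℝ} {ε z : ℂ} (hε : ‖ε‖ = 1) (hz : ‖z‖ < r)
    (hk : ∀ u : ℂ, ‖u‖ = r →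
      ‖∑ k ∈ Finset.Icc 1 m, c k * u ^ k + ∑ j ∈ Finset.range l, γ j * conj u ^ j‖ ≤
        a + 2 * (∑ k ∈ Finset.Icc 1 n, c k * u ^ k).re - κ) :
    κ ≤ a + (∑ k ∈ Finset.Icc 1 n, c k * taylorCoeffZero P k * z ^ k +
      ε * ∑ k ∈ Finset.Icc 1 m, c k * taylorCoeffZero Φ k * z ^ k).re := by
  have hr : 0 < r := (norm_nonneg z).trans_lt hz
  -- The factor `ρ < 1` goes into the arguments of `P` and `Φ`, keeping them inside the open disk;
  -- `ζ` goes into the kernel, which is thus evaluated on `|u| = r`.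
  obtain ⟨ρ, ζ, hρ0, hρ1, hζ, rfl⟩ :
      ∃ (ρ : ℝ) (ζ : ℂ), 0 ≤ ρ ∧ ρ < 1 ∧ ‖ζ‖ = r ∧ z = ρ * ζ := by
    rcases eq_or_ne z 0 with rfl | hz0
    · exact ⟨0, r, le_rfl, one_pos, by simp [hr.le], by simp⟩
    · have hn : 0 < ‖z‖ := norm_pos_iff.2 hz0
      refine ⟨‖z‖ / r, (r / ‖z‖ : ℝ) * z, by positivity, (div_lt_one hr).2 hz, ?_, ?_⟩
      · rw [norm_mul, norm_real, Real.norm_of_nonneg (by positivity)]; field_simp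
      · rw [← mul_assoc, ← ofReal_mul]
        rw [show ‖z‖ / r * (r / ‖z‖) = 1 by field_simp]; simp
  have hmaps : ∀ w ∈ sphere (0 : ℂ) |1|, (ρ : ℂ) * w ∈ ball (0 : ℂ) 1 := by
    intro w hw
    rw [abs_one, mem_sphere_zero_iff_norm] at hw
    rw [mem_ball_zero_iff, norm_mul, norm_real, Real.norm_of_nonneg hρ0, hw]
    linarith
  have hPc : ContinuousOn (fun w : ℂ => P (ρ * w)) (sphere 0 |1|) :=
    hP.continuousOn.comp (by fun_prop) hmaps
  have hΦc : ContinuousOn (fun w : ℂ => Φ (ρ * w)) (sphere 0 |1|) :=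
    hΦ.continuousOn.comp (by fun_prop) hmaps
  have hPcc : ContinuousOn (fun w : ℂ => conj (P (ρ * w))) (sphere 0 |1|) :=
    continuous_conj.comp_continuousOn hPc
  have avP : ∀ k, Real.circleAverage (fun w => P (ρ * w) * conj w ^ k) 0 1 =
      ρ ^ k * taylorCoeffZero P k := circleAverage_dilation_mul_conj_pow hP hρ0 hρ1
  have avΦ : ∀ k, Real.circleAverage (fun w => Φ (ρ * w) * conj w ^ k) 0 1 =
      ρ ^ k * taylorCoeffZero Φ k := circleAverage_dilation_mul_conj_pow hΦ hρ0 hρ1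
  have avΦ' : ∀ k, Real.circleAverage (fun w => Φ (ρ * w) * w ^ k) 0 1 = 0 := by
    intro k
    rw [circleAverage_dilation_mul_pow hΦ hρ0 hρ1, hΦ0, zero_mul]
  have avPc : ∀ k, Real.circleAverage (fun w => conj (P (ρ * w)) * conj w ^ k) 0 1 = 0 ^ k := by
    intro k
    have h := (conjCLE : ℂ →L[ℝ] ℂ).circleAverage_comp_comm (c := 0) (R := 1)
      (f := fun w : ℂ => P (ρ * w) * w ^ k) (by
        apply ContinuousOn.circleIntegrable'
        exact hPc.mul (by fun_prop))
    rw [circleAverage_dilation_mul_pow hP hρ0 hρ1, hP0] at h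
    simpa [Function.comp_def] using h
  have ciP : ∀ (x : ℂ) (k : ℕ), CircleIntegrable (fun w => x • (P (ρ * w) * conj w ^ k)) 0 1 :=
    fun x k => ContinuousOn.circleIntegrable' ((hPc.mul (by fun_prop)).const_smul x)
  have ciPc : ∀ (x : ℂ) (k : ℕ),
      CircleIntegrable (fun w => x • (conj (P (ρ * w)) * conj w ^ k)) 0 1 :=
    fun x k => ContinuousOn.circleIntegrable' ((hPcc.mul (by fun_prop)).const_smul x)
  have ciΦ : ∀ (x : ℂ) (k : ℕ), CircleIntegrable (fun w => x • (Φ (ρ * w) * conj w ^ k)) 0 1 :=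
    fun x k => ContinuousOn.circleIntegrable' ((hΦc.mul (by fun_prop)).const_smul x)
  have ciΦ' : ∀ (x : ℂ) (k : ℕ), CircleIntegrable (fun w => x • (Φ (ρ * w) * w ^ k)) 0 1 :=
    fun x k => ContinuousOn.circleIntegrable' ((hΦc.mul (by fun_prop)).const_smul x)
  -- With `u = ζ * conj w`, this is `Re P * (a - κ + 2 ∑ c_k u^k) + ε Φ * (∑ c_k u^k + ∑ γ_j (conj
  -- u)^j)`, expanded so that each term has a known average. The terms in `conj P` with `k ≥ 1` and
  -- all terms with `γ_j` average to zero.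
  set Q : ℂ → ℂ := fun w =>
    ((((a - κ : ℝ) : ℂ) / 2) • (P (ρ * w) * conj w ^ 0) +
      (((a - κ : ℝ) : ℂ) / 2) • (conj (P (ρ * w)) * conj w ^ 0)) +
    ((∑ k ∈ Finset.Icc 1 n, (c k * ζ ^ k) • (P (ρ * w) * conj w ^ k)) +
      (∑ k ∈ Finset.Icc 1 n, (c k * ζ ^ k) • (conj (P (ρ * w)) * conj w ^ k))) +
    ((∑ k ∈ Finset.Icc 1 m, (ε * c k * ζ ^ k) • (Φ (ρ * w) * conj w ^ k)) +
      (∑ j ∈ Finset.range l, (ε * γ j * conj ζ ^ j) • (Φ (ρ * w) * w ^ j))) with hQ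
  have add' : ∀ {f g : ℂ → ℂ}, CircleIntegrable f 0 1 → CircleIntegrable g 0 1 →
      CircleIntegrable (fun w => f w + g w) 0 1 := fun hf hg => hf.add hg
  have ci1 := add' (ciP ((((a - κ : ℝ) : ℂ) / 2)) 0) (ciPc ((((a - κ : ℝ) : ℂ) / 2)) 0)
  have ci2 := (CircleIntegrable.fun_sum (Finset.Icc 1 n) fun k _ => ciP (c k * ζ ^ k) k)
  have ci3 := (CircleIntegrable.fun_sum (Finset.Icc 1 n) fun k _ => ciPc (c k * ζ ^ k) k)
  have ci4 := (CircleIntegrable.fun_sum (Finset.Icc 1 m) fun k _ => ciΦ (ε * c k * ζ ^ k) k)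
  have ci5 := (CircleIntegrable.fun_sum (Finset.range l)
    fun k _ => ciΦ' (ε * γ k * conj ζ ^ k) k)
  have avQ : Real.circleAverage Q 0 1 = ((a - κ : ℝ) : ℂ) +
      (∑ k ∈ Finset.Icc 1 n, c k * taylorCoeffZero P k * (ρ * ζ) ^ k +
      ε * ∑ k ∈ Finset.Icc 1 m, c k * taylorCoeffZero Φ k * (ρ * ζ) ^ k) := by
    rw [hQ, Real.circleAverage_fun_add (add' ci1 (add' ci2 ci3)) (add' ci4 ci5),
      Real.circleAverage_fun_add ci1 (add' ci2 ci3),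
      Real.circleAverage_fun_add (ciP _ 0) (ciPc _ 0), Real.circleAverage_fun_add ci2 ci3,
      Real.circleAverage_fun_add ci4 ci5,
      Real.circleAverage_fun_sum (fun k _ => ciP _ k),
      Real.circleAverage_fun_sum (fun k _ => ciPc _ k),
      Real.circleAverage_fun_sum (fun k _ => ciΦ _ k),
      Real.circleAverage_fun_sum (fun k _ => ciΦ' _ k)]
    simp only [Real.circleAverage_fun_smul, avP, avΦ, avΦ', avPc]
    simp only [smul_eq_mul, mul_zero, Finset.sum_const_zero, add_zero]
    have h0 : ∑ k ∈ Finset.Icc 1 n, c k * ζ ^ k * (0 : ℂ) ^ k = 0 := by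
      apply Finset.sum_eq_zero
      intro k hk
      rw [zero_pow (by have := (Finset.mem_Icc.1 hk).1; omega), mul_zero]
    rw [h0, Finset.mul_sum]
    have hT : taylorCoeffZero P 0 = 1 := by simp [taylorCoeffZero, hP0]
    have s1 : ∑ k ∈ Finset.Icc 1 n, c k * ζ ^ k * (ρ ^ k * taylorCoeffZero P k) =
        ∑ k ∈ Finset.Icc 1 n, c k * taylorCoeffZero P k * (ρ * ζ) ^ k :=
      Finset.sum_congr rfl fun k _ => by rw [mul_pow]; ring
    have s2 : ∑ k ∈ Finset.Icc 1 m, ε * c k * ζ ^ k * (ρ ^ k * taylorCoeffZero Φ k) =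
        ∑ k ∈ Finset.Icc 1 m, ε * (c k * taylorCoeffZero Φ k * (ρ * ζ) ^ k) :=
      Finset.sum_congr rfl fun k _ => by rw [mul_pow]; ring
    rw [hT, s1, s2]
    ring
  have hre := reCLM.circleAverage_comp_comm (c := 0) (R := 1) (f := Q)
    (add' (add' ci1 (add' ci2 ci3)) (add' ci4 ci5))
  have hnn : 0 ≤ Real.circleAverage (reCLM ∘ Q) 0 1 := by
    apply Real.circleAverage_nonneg_of_nonneg
    intro w hw
    have hw1 : ‖w‖ = 1 := by simpa using hw
    have hww : w * conj w = 1 := by rw [mul_conj, normSq_eq_norm_sq, hw1]; simp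
    set u := ζ * conj w with hu
    have hun : ‖u‖ = r := by rw [hu, norm_mul, norm_conj, hζ, hw1, mul_one]
    have key := hk u hun
    have hΦP := hle _ (hmaps w hw)
    set A := ∑ k ∈ Finset.Icc 1 n, c k * u ^ k with hA
    set Bk := ∑ k ∈ Finset.Icc 1 m, c k * u ^ k + ∑ j ∈ Finset.range l, γ j * conj u ^ j with hB
    have hQw : Q w = (((P (ρ * w)).re : ℝ) : ℂ) * (((a - κ : ℝ) : ℂ) + 2 * A) +
        Φ (ρ * w) * (ε * Bk) := by
      have e : (((P (ρ * w)).re : ℝ) : ℂ) = (P (ρ * w) + conj (P (ρ * w))) / 2 := by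
        rw [add_conj]; push_cast; ring
      rw [e, hQ, hA, hB]
      simp only [hu, smul_eq_mul, pow_zero, mul_one, map_mul, conj_conj, mul_pow]
      rw [← Finset.sum_add_distrib]
      have e2 : ∑ k ∈ Finset.Icc 1 n, (c k * ζ ^ k * (P (ρ * w) * conj w ^ k) +
          c k * ζ ^ k * (conj (P (ρ * w)) * conj w ^ k)) =
          (P (ρ * w) + conj (P (ρ * w))) * ∑ k ∈ Finset.Icc 1 n, c k * (ζ ^ k * conj w ^ k) := by
        rw [Finset.mul_sum]; exact Finset.sum_congr rfl fun k _ => by ring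
      have e3 : ∑ k ∈ Finset.Icc 1 m, ε * c k * ζ ^ k * (Φ (ρ * w) * conj w ^ k) =
          Φ (ρ * w) * ε * ∑ k ∈ Finset.Icc 1 m, c k * (ζ ^ k * conj w ^ k) := by
        rw [Finset.mul_sum]; exact Finset.sum_congr rfl fun k _ => by ring
      have e4 : ∑ j ∈ Finset.range l, ε * γ j * conj ζ ^ j * (Φ (ρ * w) * w ^ j) =
          Φ (ρ * w) * ε * ∑ j ∈ Finset.range l, γ j * (conj ζ ^ j * w ^ j) := by
        rw [Finset.mul_sum]; exact Finset.sum_congr rfl fun k _ => by ring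
      rw [e2, e3, e4]; ring
    have h1 : -((P (ρ * w)).re * ‖Bk‖) ≤ (Φ (ρ * w) * (ε * Bk)).re := by
      have := (abs_le.1 (abs_re_le_norm (Φ (ρ * w) * (ε * Bk)))).1
      rw [norm_mul, norm_mul, hε, one_mul] at this
      nlinarith [norm_nonneg Bk]
    have hPnn : 0 ≤ (P (ρ * w)).re := (norm_nonneg _).trans hΦP
    have h2 : (Q w).re = (P (ρ * w)).re * (a - κ + 2 * A.re) + (Φ (ρ * w) * (ε * Bk)).re := by
      rw [hQw, add_re, re_ofReal_mul]; simp
    change 0 ≤ (Q w).re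
    rw [h2]
    nlinarith
  rw [hre, avQ] at hnn
  simp only [reCLM_apply, add_re, ofReal_re] at hnn ⊢
  linarith

/-! ### Univalence and convexity of harmonic maps -/

/-- Noshiro–Warschawski. -/
theorem injOn_of_re_deriv_pos {f f' : ℂ → ℂ} (hf : ∀ z, HasDerivAt f (f' z) z) {s : Set ℂ}
    (hs : Convex ℝ s) (hpos : ∀ z ∈ s, 0 < (f' z).re) : Set.InjOn f s := by
  intro a ha b hb hab
  by_contra hne
  -- Rolle's theorem is applied to `f` on the segment, projected onto the direction `b - a`.
  have hd : ∀ t : ℝ, HasDerivAt (fun t : ℝ => (f (a + t * (b - a)) * conj (b - a)).re)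
      (f' (a + t * (b - a)) * (b - a) * conj (b - a)).re t := by
    intro t
    have h1 : HasDerivAt (fun t : ℂ => a + t * (b - a)) (b - a) (t : ℂ) := by
      simpa using ((hasDerivAt_id (t : ℂ)).mul_const (b - a)).const_add a
    exact (((hf _).comp (t : ℂ) h1).mul_const (conj (b - a))).real_of_complex
  obtain ⟨t, ht, h0⟩ := exists_hasDerivAt_eq_zero (f := fun t : ℝ =>
      (f (a + t * (b - a)) * conj (b - a)).re) (zero_lt_one' ℝ)
    (fun t _ => (hd t).continuousAt.continuousWithinAt) (by simp [hab]) (fun t _ => hd t)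
  have hmem : a + t * (b - a) ∈ s := by
    have := hs ha hb (sub_nonneg.2 ht.2.le) ht.1.le (sub_add_cancel 1 t)
    convert this using 1
    simp only [real_smul]; push_cast; ring
  rw [mul_assoc, mul_conj, re_mul_ofReal] at h0
  have : 0 < normSq (b - a) := normSq_pos.2 (sub_ne_zero.2 (Ne.symm hne))
  exact (mul_pos (hpos _ hmem) this).ne' h0

/-- On a circle where the tangent of the curve `f` turns monotonically, the real part of `m f`
is maximal at the point where `m` is the direction of the outer normal. -/
theorem re_mul_le_on_sphere {f f' f'' : ℂ → ℂ} (hf : ∀ z, HasDerivAt f (f' z) z)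
    (hf' : ∀ z, HasDerivAt f' (f'' z) z) {r : ℝ} (hpos : ∀ z, ‖z‖ = r → 0 < (f' z).re)
    (hconv : ∀ z, ‖z‖ = r → 0 < (1 + z * f'' z / f' z).re) {m ζ : ℂ} {c : ℝ} (hζ : ‖ζ‖ = r)
    (hr : 0 < r) (hc : 0 < c) (hm : m * (ζ * f' ζ) = c) {w : ℂ} (hw : ‖w‖ = r) :
    (m * f w).re ≤ (m * f ζ).re := by
  have hζ0 : ζ ≠ 0 := by rintro rfl; simp at hζ; linarith
  set E : ℝ → ℂ := fun s => ζ * exp (s * I) with hE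
  have hEn : ∀ s, ‖E s‖ = r := fun s => by
    rw [hE]; simp only [norm_mul, norm_exp_ofReal_mul_I, hζ, mul_one]
  have hEd : ∀ s : ℝ, HasDerivAt E (E s * I) s := by
    intro s
    have h1 : HasDerivAt (fun t : ℂ => ζ * exp (t * I)) (ζ * (exp (s * I) * I)) (s : ℂ) := by
      have := ((hasDerivAt_id (s : ℂ)).mul_const I).cexp.const_mul ζ
      simpa using this
    have := h1.comp_ofReal
    simpa [hE, mul_assoc] using this
  have hne : ∀ z, ‖z‖ = r → f' z ≠ 0 := by
    intro z hz h
    have := hpos z hz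
    rw [h] at this; simp at this
  -- The angle turned by the tangent since `ζ`. As `Re f' > 0`, the principal logarithm is smooth
  -- along the circle and returns to its initial value, so `τ` climbs from `0` to exactly `2π`.
  set τ : ℝ → ℝ := fun s => s + (log (f' (E s))).im - arg (f' ζ) with hτ
  have hτd : ∀ s, HasDerivAt τ (1 + E s * f'' (E s) / f' (E s)).re s := by
    intro s
    have h1 : HasDerivAt (fun s : ℝ => f' (E s)) (f'' (E s) * (E s * I)) s :=
      (hf' (E s)).comp s (hEd s)
    have h2 := h1.clog_real (mem_slitPlane_iff.2 (Or.inl (hpos _ (hEn s))))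
    have h3 := imCLM.hasFDerivAt.comp_hasDerivAt s h2
    have h4 := ((hasDerivAt_id s).add h3).sub_const (arg (f' ζ))
    refine h4.congr_deriv ?_
    simp only [imCLM_apply, add_re, one_re]
    rw [show f'' (E s) * (E s * I) / f' (E s) = (E s * f'' (E s) / f' (E s)) * I by ring]
    simp
  have hτmono : Monotone τ :=
    monotone_of_deriv_nonneg (fun s => (hτd s).differentiableAt) fun s => by
      rw [(hτd s).deriv]; exact (hconv _ (hEn s)).le
  have hE0 : E 0 = ζ := by simp [hE]
  have hE2 : E (2 * Real.pi) = ζ := by simp [hE, exp_two_pi_mul_I]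
  have hτ0 : τ 0 = 0 := by simp [hτ, hE0, log_im]
  have hτ2 : τ (2 * Real.pi) = 2 * Real.pi := by simp [hτ, hE2, log_im]
  set k : ℝ → ℝ := fun s => (m * f (E s)).re with hk
  have hkd : ∀ s, HasDerivAt k (-(c * (‖f' (E s)‖ / ‖f' ζ‖) * Real.sin (τ s))) s := by
    intro s
    have h1 : HasDerivAt (fun s : ℝ => m * f (E s)) (m * (f' (E s) * (E s * I))) s :=
      ((hf (E s)).comp s (hEd s)).const_mul m
    have h3 := reCLM.hasFDerivAt.comp_hasDerivAt s h1
    refine h3.congr_deriv ?_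
    have e1 : f' (E s) = ‖f' (E s)‖ * exp (arg (f' (E s)) * I) := (norm_mul_exp_arg_mul_I _).symm
    have e2 : f' ζ = ‖f' ζ‖ * exp (arg (f' ζ) * I) := (norm_mul_exp_arg_mul_I _).symm
    have hn : (‖f' ζ‖ : ℂ) ≠ 0 := by exact_mod_cast (norm_pos_iff.2 (hne ζ hζ)).ne'
    have e3 : m * (f' (E s) * (E s * I)) =
        ((c * (‖f' (E s)‖ / ‖f' ζ‖) : ℝ) : ℂ) * exp (τ s * I) * I := by
      have : m * (f' (E s) * (E s * I)) =
          (m * (ζ * f' ζ)) * (exp (s * I) * (f' (E s) / f' ζ)) * I := by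
        have := hne ζ hζ
        field_simp
        simp [hE]; ring_nf
      rw [this, hm]
      have : exp (τ s * I) =
          exp (s * I) * (exp (arg (f' (E s)) * I) / exp (arg (f' ζ) * I)) := by
        rw [← exp_sub, ← exp_add]; congr 1; simp [hτ, log_im]; ring
      rw [this]
      nth_rw 1 [e1, e2]
      have := exp_ne_zero (arg (f' ζ) * I)
      push_cast
      field_simp
    simp only [reCLM_apply]
    have e4 : (((Real.cos (τ s) : ℝ) + (Real.sin (τ s) : ℝ) * I) * I).re = -Real.sin (τ s) := by
      rw [mul_I_re, add_im, ofReal_im, mul_I_im, ofReal_re, zero_add]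
    rw [e3, exp_mul_I, ← ofReal_cos, ← ofReal_sin, mul_assoc, re_ofReal_mul, e4]
    ring
  have hcoef : ∀ s, 0 ≤ c * (‖f' (E s)‖ / ‖f' ζ‖) := fun s => by positivity
  obtain ⟨s, hs0, hs2, rfl⟩ : ∃ s, 0 ≤ s ∧ s ≤ 2 * Real.pi ∧ E s = w := by
    have hwζ : ‖w / ζ‖ = 1 := by rw [norm_div, hw, hζ, div_self hr.ne']
    have he : w / ζ = exp (arg (w / ζ) * I) := by
      conv_lhs => rw [← norm_mul_exp_arg_mul_I (w / ζ), hwζ]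
      simp
    rcases le_or_gt 0 (arg (w / ζ)) with h | h
    · refine ⟨arg (w / ζ), h, by linarith [arg_le_pi (w / ζ), Real.pi_pos], ?_⟩
      simp only [hE]; rw [← he]; field_simp
    · refine ⟨arg (w / ζ) + 2 * Real.pi, by linarith [neg_pi_lt_arg (w / ζ)], by linarith, ?_⟩
      simp only [hE]
      push_cast
      rw [add_mul, exp_add, exp_two_pi_mul_I, mul_one, ← he]; field_simp
  have hkc : Continuous k := continuous_iff_continuousAt.2 fun s => (hkd s).continuousAt
  have hk0 : k 0 = (m * f ζ).re := by simp [hk, hE0]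
  have hk2 : k (2 * Real.pi) = (m * f ζ).re := by simp [hk, hE2]
  change k s ≤ _
  -- The derivative of `k` has the sign of `-sin τ`: `k` falls from `k 0` while `τ ≤ π` and then
  -- rises to `k (2π)`, both equal to the value at `ζ`.
  rcases le_total (τ s) Real.pi with h | h
  · rw [← hk0]
    refine antitoneOn_of_deriv_nonpos (convex_Icc 0 s) hkc.continuousOn
      (fun x _ => (hkd x).differentiableAt.differentiableWithinAt) (fun x hx => ?_)
      (Set.left_mem_Icc.2 hs0) (Set.right_mem_Icc.2 hs0) hs0
    rw [interior_Icc] at hx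
    rw [(hkd x).deriv, neg_nonpos]
    refine mul_nonneg (hcoef x) (Real.sin_nonneg_of_nonneg_of_le_pi ?_ ?_)
    · rw [← hτ0]; exact hτmono hx.1.le
    · exact (hτmono hx.2.le).trans h
  · rw [← hk2]
    refine monotoneOn_of_deriv_nonneg (convex_Icc s (2 * Real.pi)) hkc.continuousOn
      (fun x _ => (hkd x).differentiableAt.differentiableWithinAt) (fun x hx => ?_)
      (Set.left_mem_Icc.2 hs2) (Set.right_mem_Icc.2 hs2) hs2
    rw [interior_Icc] at hx
    rw [(hkd x).deriv, neg_nonneg]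
    refine mul_nonpos_of_nonneg_of_nonpos (hcoef x) ?_
    have h1 : Real.pi ≤ τ x := h.trans (hτmono hx.1.le)
    have h2 : τ x ≤ 2 * Real.pi := by rw [← hτ2]; exact hτmono hx.2.le
    rw [← Real.sin_sub_two_pi]
    exact Real.sin_nonpos_of_nonpos_of_neg_pi_le (by linarith) (by linarith)

/-- Maximum principle for `Re (m f)`. -/
theorem re_mul_le_on_ball {f : ℂ → ℂ} (hf : Differentiable ℂ f) {r M : ℝ} {m : ℂ} (hr : 0 < r)
    (h : ∀ w, ‖w‖ = r → (m * f w).re ≤ M) {z : ℂ} (hz : ‖z‖ < r) : (m * f z).re ≤ M := by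
  have hd : Differentiable ℂ fun z => exp (m * f z) := by fun_prop
  have := Complex.norm_le_of_forall_mem_frontier_norm_le (U := ball (0 : ℂ) r)
    (f := fun z => exp (m * f z)) isBounded_ball hd.diffContOnCl (C := Real.exp M)
    (fun w hw => by
      rw [frontier_ball _ hr.ne', mem_sphere_zero_iff_norm] at hw
      rw [norm_exp, Real.exp_le_exp]; exact h w hw)
    (z := z) (subset_closure (by simpa using hz))
  rwa [norm_exp, Real.exp_le_exp] at this

theorem re_mul_lt_of_isOpen {S : Set ℂ} (hS : IsOpen S) {m : ℂ} (hm : m ≠ 0) {M : ℝ}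
    (h : ∀ x ∈ S, (m * x).re ≤ M) {x : ℂ} (hx : x ∈ S) : (m * x).re < M := by
  obtain ⟨δ, hδ, hball⟩ := Metric.isOpen_iff.1 hS x hx
  have hn : 0 < ‖m‖ := norm_pos_iff.2 hm
  have h1 := h (x + (δ / (2 * ‖m‖) : ℝ) * conj m) (hball (by
    rw [mem_ball, dist_eq_norm, add_sub_cancel_left, norm_mul, norm_real, norm_conj,
      Real.norm_of_nonneg (by positivity)]
    field_simp; linarith))
  rw [mul_add, mul_left_comm, mul_conj, add_re, ← ofReal_mul, ofReal_re] at h1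
  have : 0 < δ / (2 * ‖m‖) * normSq m := mul_pos (by positivity) (normSq_pos.2 hm)
  linarith

/-- The differential `v ↦ v H' + conj (v G')` has trivial kernel because `|v G'| < |v H'|` for `v ≠
0`; in finite dimension it is then onto. -/
theorem map_nhds_add_conj {H G : ℂ → ℂ} (hH : Differentiable ℂ H) (hG : Differentiable ℂ G)
    {z : ℂ} (hlt : ‖deriv G z‖ < ‖deriv H z‖) :
    Filter.map (fun z => H z + conj (G z)) (nhds z) = nhds (H z + conj (G z)) := by
  have h1 : HasStrictFDerivAt H _ z :=
    ((hH.analyticAt z).hasStrictDerivAt.hasStrictFDerivAt).restrictScalars ℝ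
  have h2 : HasStrictFDerivAt G _ z :=
    ((hG.analyticAt z).hasStrictDerivAt.hasStrictFDerivAt).restrictScalars ℝ
  have h3 := h1.add ((conjCLE : ℂ →L[ℝ] ℂ).hasStrictFDerivAt.comp z h2)
  refine h3.map_nhds_eq_of_surj (LinearMap.range_eq_top.2 ?_)
  refine LinearMap.injective_iff_surjective.1 ?_
  refine (injective_iff_map_eq_zero _).2 fun v hv => ?_
  by_contra hv0
  have hv' : v * deriv H z + conj (v * deriv G z) = 0 := by simpa using hv
  have : ‖v * deriv H z‖ = ‖v * deriv G z‖ := by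
    rw [eq_neg_of_add_eq_zero_left hv', norm_neg, norm_conj]
  rw [norm_mul, norm_mul] at this
  have := mul_left_cancel₀ (norm_pos_iff.2 hv0).ne' this
  linarith

theorem exists_unimodular_mul_eq_norm (a : ℂ) : ∃ η : ℂ, ‖η‖ = 1 ∧ η * a = ‖a‖ := by
  rcases eq_or_ne a 0 with rfl | ha
  · exact ⟨1, by simp, by simp⟩
  · have hn : (‖a‖ : ℂ) ≠ 0 := by exact_mod_cast (norm_pos_iff.2 ha).ne'
    refine ⟨conj a / ‖a‖, ?_, ?_⟩
    · rw [norm_div, norm_conj, norm_real, norm_norm, div_self (norm_pos_iff.2 ha).ne']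
    · rw [div_mul_eq_mul_div, mul_comm, mul_conj, normSq_eq_norm_sq]
      push_cast; field_simp

/-- A harmonic mapping `H + conj G` is convex in a disk if all the analytic functions `H + ε G`,
`|ε| = 1`, satisfy there an inequality that implies `Re f' > 0` and `Re (1 + z f'' / f') > 0`. -/
theorem isConvexInDisk_of_norm_lt {H G H' G' H'' G'' : ℂ → ℂ}
    (hH : ∀ z, HasDerivAt H (H' z) z) (hG : ∀ z, HasDerivAt G (G' z) z)
    (hH' : ∀ z, HasDerivAt H' (H'' z) z) (hG' : ∀ z, HasDerivAt G' (G'' z) z) {R : ℝ}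
    (hcrit : ∀ z, ‖z‖ < R → ∀ ε : ℂ, ‖ε‖ = 1 → ‖z * (H'' z + ε * G'' z)‖ <
      (2 * (H' z + ε * G' z) + z * (H'' z + ε * G'' z)).re) :
    IsConvexInDisk (fun z => H z + conj (G z)) R := by
  have hF : ∀ ε z, HasDerivAt (fun z => H z + ε * G z) (H' z + ε * G' z) z :=
    fun ε z => (hH z).add ((hG z).const_mul ε)
  have hF' : ∀ ε z, HasDerivAt (fun z => H' z + ε * G' z) (H'' z + ε * G'' z) z :=
    fun ε z => (hH' z).add ((hG' z).const_mul ε)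
  have hpos : ∀ z, ‖z‖ < R → ∀ ε : ℂ, ‖ε‖ = 1 → 0 < (H' z + ε * G' z).re := by
    intro z hz ε hε
    have h1 := hcrit z hz ε hε
    have h2 := re_le_norm (z * (H'' z + ε * G'' z))
    rw [add_re, mul_re 2] at h1
    norm_num at h1
    norm_num at h2 ⊢
    linarith
  have hconv : ∀ z, ‖z‖ < R → ∀ ε : ℂ, ‖ε‖ = 1 →
      0 < (1 + z * (H'' z + ε * G'' z) / (H' z + ε * G' z)).re := by
    intro z hz ε hε
    have h1 := (hcrit z hz ε hε).trans_le (re_le_norm _)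
    have h0 : H' z + ε * G' z ≠ 0 := by
      intro h; have := hpos z hz ε hε; rw [h] at this; simp at this
    set D := z * (H'' z + ε * G'' z)
    set C := H' z + ε * G' z
    -- The point `D / C` is closer to `0` than to `-2`, that is, `Re (D / C) > -1`.
    have h2 : ‖D / C‖ < ‖2 + D / C‖ := by
      rw [show 2 + D / C = (2 * C + D) / C by field_simp, norm_div, norm_div]
      exact div_lt_div_of_pos_right h1 (norm_pos_iff.2 h0)
    have h3 := pow_lt_pow_left₀ h2 (norm_nonneg _) two_ne_zero
    rw [← normSq_eq_norm_sq, ← normSq_eq_norm_sq, normSq_apply, normSq_apply] at h3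
    rw [add_re, one_re]
    simp only [add_re, add_im, re_ofNat, im_ofNat] at h3
    nlinarith
  have hlt : ∀ z, ‖z‖ < R → ‖G' z‖ < ‖H' z‖ := by
    intro z hz
    obtain ⟨η, hη, he⟩ := exists_unimodular_mul_eq_norm (G' z)
    have := hpos z hz (-η) (by rwa [norm_neg])
    rw [neg_mul, he, add_re, neg_re, ofReal_re] at this
    linarith [re_le_norm (H' z)]
  have hHd : Differentiable ℂ H := fun z => (hH z).differentiableAt
  have hGd : Differentiable ℂ G := fun z => (hG z).differentiableAt
  set F : ℂ → ℂ := fun z => H z + conj (G z) with hFdef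
  have hFc : Continuous F := hHd.continuous.add (continuous_conj.comp hGd.continuous)
  have hconvlt : ∀ r, 0 < r → r < R → Convex ℝ (F '' ball 0 r) := by
    intro r hr0 hrR
    have hopen : IsOpen (F '' ball 0 r) := by
      rw [isOpen_iff_mem_nhds]
      rintro _ ⟨z, hz, rfl⟩
      have hz' : ‖z‖ < R := (mem_ball_zero_iff.1 hz).trans hrR
      have := map_nhds_add_conj hHd hGd (z := z)
        (by rw [(hH z).deriv, (hG z).deriv]; exact hlt z hz')
      change F '' ball 0 r ∈ nhds (H z + conj (G z))
      rw [← this]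
      exact Filter.image_mem_map (isOpen_ball.mem_nhds hz)
    have hsupp : ∀ ζ, ‖ζ‖ = r → ∃ m : ℂ, m ≠ 0 ∧
        ∀ x ∈ F '' ball 0 r, (m * x).re ≤ (m * F ζ).re := by
      intro ζ hζ
      have hζR : ‖ζ‖ < R := by rw [hζ]; exact hrR
      -- The tangent of `s ↦ F (ζ e^{is})` at `s = 0` is `i T`, so `T` is the normal and `m` turns
      -- it onto the positive real axis.
      set T := ζ * H' ζ - conj (ζ * G' ζ) with hT
      obtain ⟨m, hm, he⟩ := exists_unimodular_mul_eq_norm T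
      have hm0 : m ≠ 0 := by rintro rfl; simp at hm
      have hmc : m * conj m = 1 := by rw [mul_conj, normSq_eq_norm_sq, hm]; simp
      -- In the direction `m`, the harmonic map has the same real part as the analytic function with
      -- `ε = (conj m)^2`.
      have hre : ∀ x, (m * F x).re = (m * (H x + conj m ^ 2 * G x)).re := by
        intro x
        have : m * (H x + conj m ^ 2 * G x) = m * H x + conj m * G x := by
          linear_combination (conj m * G x) * hmc
        rw [this, hFdef, mul_add, add_re, add_re, ← conj_re (m * conj (G x))]
        simp
      have hε : ‖conj m ^ 2‖ = 1 := by rw [norm_pow, norm_conj, hm, one_pow]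
      have hn : ‖ζ * G' ζ‖ < ‖ζ * H' ζ‖ := by
        rw [norm_mul, norm_mul]
        exact mul_lt_mul_of_pos_left (hlt ζ hζR) (by rw [hζ]; exact hr0)
      have hT0 : 0 < ‖T‖ := by
        have := norm_sub_norm_le (ζ * H' ζ) (conj (ζ * G' ζ))
        rw [norm_conj] at this
        rw [hT]; linarith
      set X := m * (ζ * H' ζ) with hX
      set Y := m * conj (ζ * G' ζ) with hY
      have hXY : X - Y = ‖T‖ := by rw [← he, hT, hX, hY]; ring
      have hXn : ‖Y‖ < ‖X‖ := by
        rw [hX, hY, norm_mul, norm_mul m, norm_conj, hm]; linarith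
      have hval : m * (ζ * (H' ζ + conj m ^ 2 * G' ζ)) = X + conj Y := by
        rw [hX, hY]; simp only [map_mul, conj_conj]
        linear_combination (conj m * ζ * G' ζ) * hmc
      have him : X.im = Y.im := by
        have := congrArg Complex.im hXY
        simp at this; linarith
      have hrexy : X.re - Y.re = ‖T‖ := by
        have := congrArg Complex.re hXY
        simpa using this
      have hc : X + conj Y = ((X.re + Y.re : ℝ) : ℂ) := by
        apply Complex.ext <;> simp [him]
      have hcpos : 0 < X.re + Y.re := by
        have h3 := pow_lt_pow_left₀ hXn (norm_nonneg _) two_ne_zero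
        rw [← normSq_eq_norm_sq, ← normSq_eq_norm_sq, normSq_apply, normSq_apply, him] at h3
        have : 0 < (X.re - Y.re) * (X.re + Y.re) := by nlinarith
        rw [hrexy] at this
        exact (mul_pos_iff_of_pos_left hT0).1 this
      refine ⟨m, hm0, ?_⟩
      rintro _ ⟨z, hz, rfl⟩
      rw [hre, hre]
      refine re_mul_le_on_ball (f := fun z => H z + conj m ^ 2 * G z)
        (fun z => (hF _ z).differentiableAt) hr0 (fun w hw => ?_) (mem_ball_zero_iff.1 hz)
      exact re_mul_le_on_sphere (hF (conj m ^ 2)) (hF' (conj m ^ 2))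
        (fun z hz => hpos z (by rw [hz]; exact hrR) _ hε)
        (fun z hz => hconv z (by rw [hz]; exact hrR) _ hε) hζ hr0 hcpos (by rw [hval, hc]) hw
    have hcl : closure (F '' ball 0 r) ⊆ F '' closedBall 0 r :=
      closure_minimal (Set.image_mono ball_subset_closedBall)
        ((isCompact_closedBall 0 r).image hFc).isClosed
    rw [convex_iff_segment_subset]
    intro a ha b hb
    -- A connected segment that starts in the open image can leave it only through some `F ζ` with
    -- `|ζ| = r`. Both endpoints lie strictly on one side of the support line there, so the segment
    -- misses that point.
    refine (convex_segment a b).isPreconnected.subset_of_closure_inter_subset hopen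
      ⟨a, left_mem_segment ℝ a b, ha⟩ ?_
    rintro c ⟨hc, hcs⟩
    obtain ⟨ζ, hζ, rfl⟩ := hcl hc
    rcases (mem_closedBall_zero_iff.1 hζ).lt_or_eq with h | h
    · exact ⟨ζ, mem_ball_zero_iff.2 h, rfl⟩
    · exfalso
      obtain ⟨m, hm0, hm⟩ := hsupp ζ h
      have h1 := re_mul_lt_of_isOpen hopen hm0 hm ha
      have h2 := re_mul_lt_of_isOpen hopen hm0 hm hb
      obtain ⟨p, q, hp, hq, hpq, he⟩ := hcs
      have h3 : (m * F ζ).re = p * (m * a).re + q * (m * b).re := by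
        rw [← he, real_smul, real_smul, mul_add, add_re, mul_left_comm, re_ofReal_mul,
          mul_left_comm m, re_ofReal_mul]
      rcases hp.eq_or_lt with rfl | hp
      · rw [zero_add] at hpq; subst hpq; linarith
      · have h4 := mul_pos hp (sub_pos.2 h1)
        have h5 := mul_nonneg hq (sub_pos.2 h2).le
        have h6 : (p + q) * (m * F ζ).re = (m * F ζ).re := by rw [hpq, one_mul]
        linarith
  refine ⟨?_, ?_⟩
  · intro a ha b hb hab
    -- With this `ε`, a collision of `F` at `a`, `b` is a collision of `H + ε G`.
    obtain ⟨ε, hε, he⟩ : ∃ ε : ℂ, ‖ε‖ = 1 ∧ ε * (G a - G b) = conj (G a - G b) := by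
      obtain ⟨η, hη, h⟩ := exists_unimodular_mul_eq_norm (G a - G b)
      refine ⟨η ^ 2, by rw [norm_pow, hη, one_pow], ?_⟩
      have h2 : conj (η * (G a - G b)) = η * (G a - G b) := by rw [h, conj_ofReal]
      have hmc : η * conj η = 1 := by rw [mul_conj, normSq_eq_norm_sq, hη]; simp
      rw [map_mul] at h2
      linear_combination (-η) * h2 + conj (G a - G b) * hmc
    refine injOn_of_re_deriv_pos (hF ε) (convex_ball 0 R)
      (fun z hz => hpos z (mem_ball_zero_iff.1 hz) ε hε) ha hb ?_
    simp only [hFdef] at hab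
    rw [map_sub] at he
    simp only
    linear_combination hab + he
  · intro r hr0 hrR
    rw [convex_iff_segment_subset]
    rintro _ ⟨a, ha, rfl⟩ _ ⟨b, hb, rfl⟩
    rw [mem_ball_zero_iff] at ha hb
    obtain ⟨s, hs1, hs2⟩ := exists_between (max_lt ha hb)
    have hs0 : 0 < s := (norm_nonneg a).trans_lt ((le_max_left _ _).trans_lt hs1)
    refine ((hconvlt s hs0 (hs2.trans_le hrR)).segment_subset
      ⟨a, mem_ball_zero_iff.2 ((le_max_left _ _).trans_lt hs1), rfl⟩
      ⟨b, mem_ball_zero_iff.2 ((le_max_right _ _).trans_lt hs1), rfl⟩).trans ?_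
    exact Set.image_mono (ball_subset_ball hs2.le)

/-! ### Reduction to `α = 0` -/

/-- If `Re (φ + α z φ') > b` in the disk, then `Re φ > b`: along each ray the function
`t ^ (1 / α) (Re φ - b)` increases. -/
theorem lt_re_of_lt_re_add_mul_deriv {φ : ℂ → ℂ} (hφ : DifferentiableOn ℂ φ (ball 0 1)) {α b : ℝ}
    (hα : 0 ≤ α) (h : ∀ z ∈ ball (0 : ℂ) 1, b < (φ z + α * z * deriv φ z).re) {z : ℂ}
    (hz : z ∈ ball (0 : ℂ) 1) : b < (φ z).re := by
  rcases hα.eq_or_lt with rfl | hα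
  · simpa using h z hz
  have hmem : ∀ t ∈ Set.Icc (0 : ℝ) 1, (t : ℂ) * z ∈ ball (0 : ℂ) 1 := by
    intro t ht
    rw [mem_ball_zero_iff] at hz ⊢
    rw [norm_mul, norm_real, Real.norm_of_nonneg ht.1]
    nlinarith [norm_nonneg z, ht.2]
  have hd : ∀ t ∈ Set.Icc (0 : ℝ) 1, HasDerivAt (fun t : ℝ => (φ (t * z)).re - b)
      (deriv φ (t * z) * z).re t := by
    intro t ht
    have h1 : HasDerivAt φ (deriv φ (t * z)) (t * z) :=
      (hφ.differentiableAt (isOpen_ball.mem_nhds (hmem t ht))).hasDerivAt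
    have h2 : HasDerivAt (fun t : ℂ => t * z) z (t : ℂ) := by
      simpa using (hasDerivAt_id (t : ℂ)).mul_const z
    exact ((h1.comp (t : ℂ) h2).real_of_complex).sub_const b
  have hαi : 0 < 1 / α := by positivity
  have hmono : StrictMonoOn (fun t : ℝ => t ^ (1 / α) * ((φ (t * z)).re - b)) (Set.Icc 0 1) := by
    apply strictMonoOn_of_deriv_pos (convex_Icc 0 1)
    · intro t ht
      exact ((Real.continuousAt_rpow_const t _ (Or.inr hαi.le)).mul
        (hd t ht).continuousAt).continuousWithinAt
    · intro t ht
      rw [interior_Icc] at ht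
      have ht' := Set.Ioo_subset_Icc_self ht
      have hd2 := (Real.hasDerivAt_rpow_const (p := 1 / α) (Or.inl ht.1.ne')).mul (hd t ht')
      have h3 := h _ (hmem t ht')
      have he : (φ (t * z) + α * (t * z) * deriv φ (t * z)).re =
          (φ (t * z)).re + α * t * (deriv φ (t * z) * z).re := by
        rw [add_re, show (α : ℂ) * (t * z) * deriv φ (t * z) =
          ((α * t : ℝ) : ℂ) * (deriv φ (t * z) * z) by push_cast; ring, re_ofReal_mul]
      rw [he] at h3
      have e2 : t ^ (1 / α) = t ^ (1 / α - 1) * t := by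
        rw [← Real.rpow_add_one ht.1.ne', sub_add_cancel]
      have hp : 0 < t ^ (1 / α - 1) := Real.rpow_pos_of_pos ht.1 _
      have e3 : 1 / α * t ^ (1 / α - 1) * ((φ (t * z)).re - b) +
          t ^ (1 / α) * (deriv φ (t * z) * z).re =
          t ^ (1 / α - 1) / α *
            ((φ (t * z)).re + α * t * (deriv φ (t * z) * z).re - b) := by
        rw [e2]; field_simp; ring
      have h4 := hd2.deriv
      change deriv (fun t : ℝ => t ^ (1 / α) * ((φ (t * z)).re - b)) t = _ at h4
      rw [h4, e3]
      exact mul_pos (by positivity) (by linarith)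
  have := hmono (Set.left_mem_Icc.2 zero_le_one) (Set.right_mem_Icc.2 zero_le_one) one_pos
  simp only [Real.zero_rpow hαi.ne', zero_mul, Real.one_rpow, one_mul, ofReal_one] at this
  linarith

/-- The ray argument applies to `h' - η g'` with `η` frozen so that `η g' = |g'|` at the given
point. -/
theorem MemWH.norm_deriv_lt {α β : ℝ} (hα : 0 ≤ α) {h g : ℂ → ℂ} (hm : MemWH α β h g) {z : ℂ}
    (hz : z ∈ ball (0 : ℂ) 1) : ‖deriv g z‖ < (deriv h z).re - β := by
  obtain ⟨η, hη, he⟩ := exists_unimodular_mul_eq_norm (deriv g z)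
  have hdh := hm.diff_h.deriv isOpen_ball
  have hdg := hm.diff_g.deriv isOpen_ball
  have key := lt_re_of_lt_re_add_mul_deriv (φ := fun z => deriv h z - η * deriv g z) (b := β)
    (hdh.sub (hdg.const_mul η)) hα (fun w hw => by
      have h1 : HasDerivAt (fun z => deriv h z - η * deriv g z)
          (deriv (deriv h) w - η * deriv (deriv g) w) w :=
        (hdh.differentiableAt (isOpen_ball.mem_nhds hw)).hasDerivAt.sub
          ((hdg.differentiableAt (isOpen_ball.mem_nhds hw)).hasDerivAt.const_mul η)
      rw [h1.deriv]
      have h2 := hm.re_gt w hw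
      have h3 := re_le_norm (η * (deriv g w + α * w * deriv (deriv g) w))
      rw [norm_mul, hη, one_mul] at h3
      have e : deriv h w - η * deriv g w +
          α * w * (deriv (deriv h) w - η * deriv (deriv g) w) =
          (deriv h w + α * w * deriv (deriv h) w) -
            η * (deriv g w + α * w * deriv (deriv g) w) := by ring
      rw [e, sub_re]
      rw [sub_re, ofReal_re] at h2
      linarith) hz
  rw [he, sub_re, ofReal_re] at key
  linarith

/-! ### From convexity of sections to a kernel inequality -/

theorem taylorCoeffZero_succ (f : ℂ → ℂ) (k : ℕ) :
    (k + 1) * taylorCoeffZero f (k + 1) = taylorCoeffZero (deriv f) k := by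
  rw [taylorCoeffZero, taylorCoeffZero, iteratedDeriv_succ', Nat.factorial_succ]
  have h1 : ((k : ℂ) + 1) ≠ 0 := by exact_mod_cast k.succ_ne_zero
  have h2 : (k.factorial : ℂ) ≠ 0 := by exact_mod_cast k.factorial_ne_zero
  push_cast
  field_simp

theorem hasDerivAt_analyticSection (f : ℂ → ℂ) (n : ℕ) (z : ℂ) :
    HasDerivAt (analyticSection (n + 1) f)
      (deriv f 0 + ∑ k ∈ Finset.Icc 1 n, taylorCoeffZero (deriv f) k * z ^ k) z := by
  have h1 : HasDerivAt (fun z => ∑ k ∈ Finset.Icc 1 (n + 1), taylorCoeffZero f k * z ^ k)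
      (∑ k ∈ Finset.Icc 1 (n + 1), taylorCoeffZero f k * (k * z ^ (k - 1))) z :=
    HasDerivAt.fun_sum fun k _ => (hasDerivAt_pow k z).const_mul _
  refine h1.congr_deriv ?_
  induction n with
  | zero => simp [taylorCoeffZero]
  | succ n ih =>
    rw [Finset.sum_Icc_succ_top (by omega), ih, Finset.sum_Icc_succ_top (by omega),
      ← taylorCoeffZero_succ f (n + 1)]
    · push_cast; ring
    · exact HasDerivAt.fun_sum fun k _ => (hasDerivAt_pow k z).const_mul _

theorem hasDerivAt_sum_Icc_mul_pow (b : ℂ) (c : ℕ → ℂ) (n : ℕ) (z : ℂ) :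
    HasDerivAt (fun z => b + ∑ k ∈ Finset.Icc 1 n, c k * z ^ k)
      (∑ k ∈ Finset.Icc 1 n, c k * (k * z ^ (k - 1))) z :=
  (HasDerivAt.fun_sum fun k _ => (hasDerivAt_pow k z).const_mul _).const_add b

theorem taylorCoeffZero_const_mul_sub_const (f : ℂ → ℂ) (b c : ℂ) {k : ℕ} (hk : 1 ≤ k) :
    taylorCoeffZero (fun z => c * (f z - b)) k = c * taylorCoeffZero f k := by
  obtain ⟨j, rfl⟩ := Nat.exists_eq_add_of_le' hk
  have : deriv (fun z => c * (f z - b)) = fun z => c * deriv f z := by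
    ext z; rw [deriv_const_mul_field, deriv_sub_const]
  rw [taylorCoeffZero, taylorCoeffZero, iteratedDeriv_succ', iteratedDeriv_succ', this,
    iteratedDeriv_const_mul_field, mul_div_assoc]

/-- The factor `2 + (1 - η) k` is the multiplier of `2 f' + (1 - η) z f''` on the `k`-th coefficient
of `f'`. Differentiation lowers degrees, hence `n + 1` and `m + 1` for the sections. The kernel
bound contributes `(1 - β) κ`, and the constant `β` removed from `h'` contributes `2β`. -/
theorem isConvexInDisk_harmonicSection {α β : ℝ} (hα : 0 ≤ α) (hβ : β < 1) {h g : ℂ → ℂ}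
    (hm : MemWH α β h g) {n m : ℕ} {R r κ : ℝ} (hRr : R ≤ r) (hκ : 0 < 2 * β + (1 - β) * κ)
    (hk : ∀ η : ℂ, ‖η‖ = 1 → ∃ (l : ℕ) (γ : ℕ → ℂ), ∀ u : ℂ, ‖u‖ = r →
      ‖∑ k ∈ Finset.Icc 1 m, (2 + (1 - η) * k) * u ^ k +
          ∑ j ∈ Finset.range l, γ j * conj u ^ j‖ ≤
        2 + 2 * (∑ k ∈ Finset.Icc 1 n, (2 + (1 - η) * k) * u ^ k).re - κ) :
    IsConvexInDisk (harmonicSection (n + 1) (m + 1) h g) R := by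
  have hB : 0 < 1 - β := by linarith
  have hBc : ((1 - β : ℝ) : ℂ) ≠ 0 := by exact_mod_cast hB.ne'
  set B : ℂ := ((1 - β : ℝ) : ℂ) with hBdef
  set P : ℂ → ℂ := fun z => B⁻¹ * (deriv h z - β) with hP
  set Φ : ℂ → ℂ := fun z => B⁻¹ * (deriv g z - 0) with hΦ
  have hdh := hm.diff_h.deriv isOpen_ball
  have hdg := hm.diff_g.deriv isOpen_ball
  have hcP : ∀ k ∈ Finset.Icc 1 n, taylorCoeffZero (deriv h) k = B * taylorCoeffZero P k :=
    fun k hk => by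
      rw [hP, taylorCoeffZero_const_mul_sub_const _ _ _ (Finset.mem_Icc.1 hk).1,
        mul_inv_cancel_left₀ hBc]
  have hcΦ : ∀ k ∈ Finset.Icc 1 m, taylorCoeffZero (deriv g) k = B * taylorCoeffZero Φ k :=
    fun k hk => by
      rw [hΦ, taylorCoeffZero_const_mul_sub_const _ _ _ (Finset.mem_Icc.1 hk).1,
        mul_inv_cancel_left₀ hBc]
  refine isConvexInDisk_of_norm_lt (hasDerivAt_analyticSection h n)
    (hasDerivAt_analyticSection g m) (hasDerivAt_sum_Icc_mul_pow _ _ n)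
    (hasDerivAt_sum_Icc_mul_pow _ _ m) fun z hz ε hε => ?_
  rw [hm.deriv_h_zero, hm.deriv_g_zero]
  set D := z * (∑ k ∈ Finset.Icc 1 n, taylorCoeffZero (deriv h) k * (k * z ^ (k - 1)) +
    ε * ∑ k ∈ Finset.Icc 1 m, taylorCoeffZero (deriv g) k * (k * z ^ (k - 1))) with hD
  obtain ⟨η, hη, he⟩ := exists_unimodular_mul_eq_norm D
  obtain ⟨l, γ, hγ⟩ := hk η hη
  have key := le_re_section_of_kernel (P := P) (Φ := Φ) ((hdh.sub_const _).const_mul _)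
    ((hdg.sub_const _).const_mul _)
    (by
      simp only [hP, hm.deriv_h_zero]
      rw [← ofReal_one, ← ofReal_sub, ← hBdef, inv_mul_cancel₀ hBc]
      exact ofReal_one.symm)
    (by simp [hΦ, hm.deriv_g_zero]) (fun w hw => by
      have h1 := hm.norm_deriv_lt hα hw
      have h2 : P w = ((1 - β)⁻¹ : ℝ) * (deriv h w - β) := by
        rw [hP, hBdef, ofReal_inv]
      rw [h2, re_ofReal_mul, hΦ, hBdef, ← ofReal_inv]
      simp only [sub_zero, norm_mul, norm_real, sub_re, ofReal_re]
      rw [Real.norm_of_nonneg (by positivity)]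
      gcongr) hε (hz.trans_le hRr) hγ
  -- Since `η D = |D|`, the real part of the left side is `Re (2 f' + z f'') - |z f''|`.
  have hexp : 2 * (1 + ∑ k ∈ Finset.Icc 1 n, taylorCoeffZero (deriv h) k * z ^ k +
      ε * (0 + ∑ k ∈ Finset.Icc 1 m, taylorCoeffZero (deriv g) k * z ^ k)) + D - η * D =
      ((2 * β : ℝ) : ℂ) + ((1 - β : ℝ) : ℂ) * (2 +
        (∑ k ∈ Finset.Icc 1 n, (2 + (1 - η) * k) * taylorCoeffZero P k * z ^ k +
        ε * ∑ k ∈ Finset.Icc 1 m, (2 + (1 - η) * k) * taylorCoeffZero Φ k * z ^ k)) := by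
    have e1 : ∀ (f F : ℂ → ℂ) (n : ℕ), (∀ k ∈ Finset.Icc 1 n, taylorCoeffZero f k =
        B * taylorCoeffZero F k) →
        2 * ∑ k ∈ Finset.Icc 1 n, taylorCoeffZero f k * z ^ k +
          (1 - η) * (z * ∑ k ∈ Finset.Icc 1 n, taylorCoeffZero f k * (k * z ^ (k - 1))) =
        B * ∑ k ∈ Finset.Icc 1 n, (2 + (1 - η) * k) * taylorCoeffZero F k * z ^ k := by
      intro f F n hfF
      rw [Finset.mul_sum, Finset.mul_sum, Finset.mul_sum, Finset.mul_sum,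
        ← Finset.sum_add_distrib]
      refine Finset.sum_congr rfl fun k hk => ?_
      rw [hfF k hk, ← mul_pow_sub_one (n := k) (by have := (Finset.mem_Icc.1 hk).1; omega) z]
      ring
    rw [← hBdef]
    have h2 : (2 : ℂ) = ((2 * β : ℝ) : ℂ) + B * 2 := by rw [hBdef]; push_cast; ring
    linear_combination e1 _ _ _ hcP + ε * e1 _ _ _ hcΦ + h2
  have hre := congrArg Complex.re hexp
  rw [he, sub_re, ofReal_re, add_re, add_re, ofReal_re, re_ofReal_mul, add_re 2, re_ofNat] at hre
  rw [add_re]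
  have := mul_le_mul_of_nonneg_left key hB.le
  linarith

/-! ### Elementary estimates -/

/-- The bound is the full tail `∑_{k ≥ a} (k + 1) r^k`; the finite sum is the difference of two such
tails. -/
theorem sum_Icc_succ_mul_pow_le {r : ℝ} (h0 : 0 ≤ r) (h1 : r < 1) (a n : ℕ) :
    ∑ k ∈ Finset.Icc a n, ((k : ℝ) + 1) * r ^ k ≤ r ^ a * (a + 1 - a * r) / (1 - r) ^ 2 := by
  have hr : 0 < 1 - r := by linarith
  have hg : ∀ k : ℕ, 0 ≤ r ^ k * (k + 1 - k * r) / (1 - r) ^ 2 := fun k => by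
    have : (0 : ℝ) ≤ k + 1 - k * r := by nlinarith [(Nat.cast_nonneg k : (0 : ℝ) ≤ k)]
    positivity
  rcases lt_or_ge n a with h | h
  · rw [Finset.Icc_eq_empty (by omega), Finset.sum_empty]; exact hg a
  have key : ∑ k ∈ Finset.Icc a n, ((k : ℝ) + 1) * r ^ k =
      r ^ a * (a + 1 - a * r) / (1 - r) ^ 2 -
        r ^ (n + 1) * ((n + 1 : ℕ) + 1 - (n + 1 : ℕ) * r) / (1 - r) ^ 2 := by
    induction n, h using Nat.le_induction with
    | base =>
      rw [Finset.Icc_self, Finset.sum_singleton]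
      field_simp; push_cast; ring
    | succ n hn ih =>
      rw [Finset.sum_Icc_succ_top (by omega), ih]
      field_simp; push_cast; ring
  rw [key]
  linarith [hg (n + 1)]

theorem norm_two_add_le {η : ℂ} (hη : ‖η‖ = 1) (k : ℕ) :
    ‖2 + (1 - η) * k‖ ≤ 2 * ((k : ℝ) + 1) := by
  have h1 := norm_add_le (2 : ℂ) ((1 - η) * k)
  have h2 := norm_sub_le (1 : ℂ) η
  rw [norm_mul, norm_natCast] at h1
  rw [norm_one, hη] at h2
  have h3 : ‖(2 : ℂ)‖ = 2 := by simp
  nlinarith [(Nat.cast_nonneg k : (0 : ℝ) ≤ k)]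

theorem norm_sum_Icc_two_add_mul_pow_le {η u : ℂ} (hη : ‖η‖ = 1) {r : ℝ} (hu : ‖u‖ = r)
    (h1 : r < 1) (a n : ℕ) :
    ‖∑ k ∈ Finset.Icc a n, (2 + (1 - η) * k) * u ^ k‖ ≤
      2 * (r ^ a * (a + 1 - a * r) / (1 - r) ^ 2) := by
  have h0 : 0 ≤ r := hu ▸ norm_nonneg u
  refine (norm_sum_le _ _).trans (le_trans ?_
    (mul_le_mul_of_nonneg_left (sum_Icc_succ_mul_pow_le h0 h1 a n) zero_le_two))
  rw [Finset.mul_sum]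
  refine Finset.sum_le_sum fun k _ => ?_
  rw [norm_mul, norm_pow, hu, ← mul_assoc]
  exact mul_le_mul_of_nonneg_right (norm_two_add_le hη k) (by positivity)

theorem norm_le_of_sq_add_sq_le {v : ℂ} {c : ℝ} (hc : 0 ≤ c) (h : v.re ^ 2 + v.im ^ 2 ≤ c ^ 2) :
    ‖v‖ ≤ c := by
  rw [← sq_le_sq₀ (norm_nonneg v) hc, ← normSq_eq_norm_sq, normSq_apply]
  linarith

/-- AM-GM: it trades a modulus for its square, which on `|u| = r` is a polynomial in `Re u`. -/
theorem norm_le_half_div_add {v : ℂ} {s : ℝ} (hs : 0 < s) :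
    ‖v‖ ≤ ((v.re ^ 2 + v.im ^ 2) / s + s) / 2 := by
  have h : v.re ^ 2 + v.im ^ 2 = ‖v‖ ^ 2 := by rw [← normSq_eq_norm_sq, normSq_apply]; ring
  rw [h, ← sub_nonneg]
  have : (‖v‖ ^ 2 / s + s) / 2 - ‖v‖ = (‖v‖ - s) ^ 2 / (2 * s) := by field_simp; ring
  rw [this]; positivity

theorem sum_Icc_eq_add_sum_Icc_succ (f : ℕ → ℂ) {a n : ℕ} (h : a ≤ n) :
    ∑ k ∈ Finset.Icc a n, f k = f a + ∑ k ∈ Finset.Icc (a + 1) n, f k := by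
  rw [← Finset.add_sum_Ioc_eq_sum_Icc h, Finset.Icc_add_one_left_eq_Ioc]

/-! ### Kernels for `s_{2,q}` -/

theorem kernel_two_sections_small {m : ℕ} (hm : 2 ≤ m) {η : ℂ} (hη : ‖η‖ = 1) :
    ∃ (l : ℕ) (γ : ℕ → ℂ), ∀ u : ℂ, ‖u‖ = 427 / 2000 →
      ‖∑ k ∈ Finset.Icc 1 m, (2 + (1 - η) * k) * u ^ k + ∑ j ∈ Finset.range l, γ j * conj u ^ j‖ ≤
        2 + 2 * (∑ k ∈ Finset.Icc 1 (1 : ℕ), (2 + (1 - η) * k) * u ^ k).re - 1 / 50 := by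
  -- Numerically chosen shifts: `441/1000` recentres `3u + 4u²`, and `953/10000` recentres `u +
  -- 2u²`, the factor of `-η`.
  refine ⟨1, fun _ => ((441 / 1000 : ℝ) : ℂ) - η * ((953 / 10000 : ℝ) : ℂ), fun u hu => ?_⟩
  have htail := norm_sum_Icc_two_add_mul_pow_le hη hu (by norm_num) 3 m
  rw [sum_Icc_eq_add_sum_Icc_succ _ (by omega : 1 ≤ m), sum_Icc_eq_add_sum_Icc_succ _ hm]
  set S := ∑ k ∈ Finset.Icc 3 m, (2 + (1 - η) * k) * u ^ k with hS
  have hS' : ‖S‖ ≤ 106 / 1000 := htail.trans (by norm_num)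
  have hx : u.re ^ 2 + u.im ^ 2 = (427 / 2000) ^ 2 := by
    rw [← hu, ← normSq_eq_norm_sq, normSq_apply]; ring
  have hη1 : (η * u).re ≤ 427 / 2000 := by
    have := re_le_norm (η * u); rwa [norm_mul, hη, hu, one_mul] at this
  set x := u.re with hxdef
  set y := u.im with hydef
  have hxl : -(427 / 2000) ≤ x := by nlinarith [sq_nonneg y]
  have hxu : x ≤ 427 / 2000 := by nlinarith [sq_nonneg y]
  have hy : y ^ 2 = (427 / 2000) ^ 2 - x ^ 2 := by linarith
  -- The budget left after `Re (η u) ≤ r` and the tail bound, before the margin `1/50`. The two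
  -- moduli use `3W/5` and `W/5`; the remaining `W/5` covers the margin.
  set W := 2 + 6 * x - 427 / 1000 - 106 / 1000 with hW
  have hW0 : 186 / 1000 - 1 / 1000 ≤ W := by linarith
  have h1 : ‖u + 2 * u ^ 2 + ((953 / 10000 : ℝ) : ℂ)‖ ≤ W / 5 := by
    apply norm_le_of_sq_add_sq_le (by linarith)
    have e1 : (u + 2 * u ^ 2 + ((953 / 10000 : ℝ) : ℂ)).re =
        x + 2 * (2 * x ^ 2 - (427 / 2000) ^ 2) + 953 / 10000 := by
      simp [pow_two, ← hxdef, ← hydef] at *; linarith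
    have e2 : (u + 2 * u ^ 2 + ((953 / 10000 : ℝ) : ℂ)).im = y * (1 + 4 * x) := by
      simp [pow_two, ← hxdef, ← hydef]; ring
    rw [e1, e2, mul_pow, hy, hW]
    nlinarith [mul_nonneg (sub_nonneg.2 hxl) (sub_nonneg.2 hxu)]
  have h2 : ‖3 * u + 4 * u ^ 2 + ((441 / 1000 : ℝ) : ℂ)‖ ≤ 3 * W / 5 := by
    apply norm_le_of_sq_add_sq_le (by linarith)
    have e1 : (3 * u + 4 * u ^ 2 + ((441 / 1000 : ℝ) : ℂ)).re =
        3 * x + 4 * (2 * x ^ 2 - (427 / 2000) ^ 2) + 441 / 1000 := by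
      simp [pow_two, ← hxdef, ← hydef] at *; linarith
    have e2 : (3 * u + 4 * u ^ 2 + ((441 / 1000 : ℝ) : ℂ)).im = y * (3 + 8 * x) := by
      simp [pow_two, ← hxdef, ← hydef]; ring
    rw [e1, e2, mul_pow, hy, hW]
    nlinarith [mul_nonneg (sub_nonneg.2 hxl) (sub_nonneg.2 hxu)]
  have e : (2 + (1 - η) * (1 : ℕ)) * u ^ 1 + ((2 + (1 - η) * (2 : ℕ)) * u ^ 2 + S) +
      ∑ j ∈ Finset.range 1, (((441 / 1000 : ℝ) : ℂ) - η * ((953 / 10000 : ℝ) : ℂ)) * conj u ^ j =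
      (3 * u + 4 * u ^ 2 + ((441 / 1000 : ℝ) : ℂ)) -
        η * (u + 2 * u ^ 2 + ((953 / 10000 : ℝ) : ℂ)) + S := by
    rw [Finset.sum_range_one]; push_cast; ring
  have e' : (∑ k ∈ Finset.Icc 1 (1 : ℕ), (2 + (1 - η) * k) * u ^ k).re = 3 * x - (η * u).re := by
    rw [Finset.Icc_self, Finset.sum_singleton]
    rw [show (2 + (1 - η) * (1 : ℕ)) * u ^ 1 = 3 * u - η * u by push_cast; ring, sub_re]
    simp [hxdef]
  rw [e, e']
  have h3 := (norm_add_le ((3 * u + 4 * u ^ 2 + ((441 / 1000 : ℝ) : ℂ)) -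
        η * (u + 2 * u ^ 2 + ((953 / 10000 : ℝ) : ℂ))) S).trans
    (add_le_add_left (norm_sub_le _ _) _)
  rw [norm_mul η, hη, one_mul] at h3
  linarith

theorem kernel_two_sections_large {m : ℕ} (hm : 1 ≤ m) {r : ℝ} (h1 : r < 1) {η : ℂ}
    (hη : ‖η‖ = 1) :
    ∃ (l : ℕ) (γ : ℕ → ℂ), ∀ u : ℂ, ‖u‖ = r →
      ‖∑ k ∈ Finset.Icc 1 m, (2 + (1 - η) * k) * u ^ k + ∑ j ∈ Finset.range l, γ j * conj u ^ j‖ ≤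
        2 + 2 * (∑ k ∈ Finset.Icc 1 (1 : ℕ), (2 + (1 - η) * k) * u ^ k).re -
          (2 - 8 * r - 2 * (r ^ 2 * (3 - 2 * r) / (1 - r) ^ 2)) := by
  set w := 2 + (1 - η) * (1 : ℕ) with hw
  have hw4 : ‖w‖ ≤ 4 := (norm_two_add_le hη 1).trans (by norm_num)
  -- Adding `conj (w u) + 2|w| r` turns `w u` into a nonnegative real number whose variable part `2
  -- Re (w u)` cancels against the right side.
  refine ⟨2, fun j => if j = 0 then ((2 * (‖w‖ * r) : ℝ) : ℂ) else conj w, fun u hu => ?_⟩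
  have htail := norm_sum_Icc_two_add_mul_pow_le hη hu h1 2 m
  rw [sum_Icc_eq_add_sum_Icc_succ _ hm, Finset.Icc_self, Finset.sum_singleton,
    Finset.sum_range_succ, Finset.sum_range_one, ← hw]
  set S := ∑ k ∈ Finset.Icc (1 + 1) m, (2 + (1 - η) * k) * u ^ k with hS
  have hr0 : 0 ≤ r := hu ▸ norm_nonneg u
  have habs := (abs_le.1 (abs_re_le_norm (w * u))).1
  rw [norm_mul, hu] at habs
  have e : w * u ^ 1 + S + ((if 0 = 0 then ((2 * (‖w‖ * r) : ℝ) : ℂ) else conj w) * conj u ^ 0 +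
      (if 1 = 0 then ((2 * (‖w‖ * r) : ℝ) : ℂ) else conj w) * conj u ^ 1) =
      ((2 * (w * u).re + 2 * (‖w‖ * r) : ℝ) : ℂ) + S := by
    have := add_conj (w * u)
    rw [map_mul] at this
    simp only [if_true, one_ne_zero, if_false]
    push_cast at this ⊢
    linear_combination this
  rw [e, pow_one]
  refine (norm_add_le _ _).trans ?_
  rw [norm_real, Real.norm_of_nonneg (by linarith)]
  have h4 : ‖w‖ * r ≤ 4 * r := mul_le_mul_of_nonneg_right hw4 hr0
  have h5 : ‖S‖ ≤ 2 * (r ^ 2 * (3 - 2 * r) / (1 - r) ^ 2) := by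
    refine htail.trans (le_of_eq ?_); push_cast; ring
  linarith

/-! ### Kernels for `s_{p,2}` -/

/-- Auxiliary terms `δ r + c ū + (f / r) ū ^ 2` do not change the mean value against `Φ`; they
balance the size of the kernel on the circle `|u| = r`. -/
theorem kernel_of_pointwise {n : ℕ} {r κ d c f : ℝ} {η : ℂ} (hη : ‖η‖ = 1)
    (h : ∀ u : ℂ, ‖u‖ = r →
      4 * ‖u + ((d : ℝ) : ℂ) + (c : ℝ) * conj u + (f : ℝ) * conj u ^ 2‖ ≤
        2 + 2 * (∑ k ∈ Finset.Icc 1 n, (2 + (1 - η) * k) * u ^ k).re - κ) :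
    ∃ (l : ℕ) (γ : ℕ → ℂ), ∀ u : ℂ, ‖u‖ = r →
      ‖∑ k ∈ Finset.Icc 1 (1 : ℕ), (2 + (1 - η) * k) * u ^ k +
          ∑ j ∈ Finset.range l, γ j * conj u ^ j‖ ≤
        2 + 2 * (∑ k ∈ Finset.Icc 1 n, (2 + (1 - η) * k) * u ^ k).re - κ := by
  set w := 2 + (1 - η) * (1 : ℕ) with hw
  have hw4 : ‖w‖ ≤ 4 := (norm_two_add_le hη 1).trans (by norm_num)
  -- Scaling the auxiliary terms by `w` lets `|w| ≤ 4` factor out, so the left side no longer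
  -- depends on `η`.
  refine ⟨3, fun j => w * (if j = 0 then (d : ℂ) else if j = 1 then (c : ℂ) else f),
    fun u hu => ?_⟩
  refine le_trans ?_ (h u hu)
  rw [Finset.Icc_self, Finset.sum_singleton, Finset.sum_range_succ, Finset.sum_range_succ,
    Finset.sum_range_one, ← hw]
  have e : w * u ^ 1 + (w * (if 0 = 0 then (d : ℂ) else if 0 = 1 then (c : ℂ) else f) * conj u ^ 0 +
      w * (if 1 = 0 then (d : ℂ) else if 1 = 1 then (c : ℂ) else f) * conj u ^ 1 +
      w * (if 2 = 0 then (d : ℂ) else if 2 = 1 then (c : ℂ) else f) * conj u ^ 2) =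
      w * (u + (d : ℝ) + (c : ℝ) * conj u + (f : ℝ) * conj u ^ 2) := by
    norm_num; ring
  rw [e, norm_mul]
  exact mul_le_mul_of_nonneg_right hw4 (norm_nonneg _)

theorem kernel_sections_two_of_eq_two {η : ℂ} (hη : ‖η‖ = 1) :
    ∃ (l : ℕ) (γ : ℕ → ℂ), ∀ u : ℂ, ‖u‖ = 117 / 500 →
      ‖∑ k ∈ Finset.Icc 1 (1 : ℕ), (2 + (1 - η) * k) * u ^ k +
          ∑ j ∈ Finset.range l, γ j * conj u ^ j‖ ≤
        2 + 2 * (∑ k ∈ Finset.Icc 1 (2 : ℕ), (2 + (1 - η) * k) * u ^ k).re - 1 / 50 := by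
  refine kernel_of_pointwise (d := 7 / 10 * (117 / 500)) (c := 7 / 20) (f := 0) hη fun u hu => ?_
  have e' : (∑ k ∈ Finset.Icc 1 (2 : ℕ), (2 + (1 - η) * k) * u ^ k).re =
      (3 * u + 4 * u ^ 2).re - (η * (u + 2 * u ^ 2)).re := by
    rw [sum_Icc_eq_add_sum_Icc_succ _ one_le_two, show 1 + 1 = 2 from rfl, Finset.Icc_self, Finset.sum_singleton, ← sub_re]
    congr 1; push_cast; ring
  have hη1 := re_le_norm (η * (u + 2 * u ^ 2))
  rw [norm_mul, hη, one_mul] at hη1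
  have hx : u.re ^ 2 + u.im ^ 2 = (117 / 500) ^ 2 := by
    rw [← hu, ← normSq_eq_norm_sq, normSq_apply]; ring
  rw [e']
  have hD := norm_le_half_div_add (v := u + 2 * u ^ 2) (s := 1 / 5) (by norm_num)
  have hV := norm_le_half_div_add (v := u + ((7 / 10 * (117 / 500) : ℝ) : ℂ) +
    ((7 / 20 : ℝ) : ℂ) * conj u + ((0 : ℝ) : ℂ) * conj u ^ 2) (s := 4 / 5 * (117 / 500))
    (by norm_num)
  set x := u.re with hxdef
  set y := u.im with hydef
  have hxl : -(117 / 500) ≤ x := by nlinarith [sq_nonneg y]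
  have hxu : x ≤ 117 / 500 := by nlinarith [sq_nonneg y]
  have hy : y ^ 2 = (117 / 500) ^ 2 - x ^ 2 := by linarith
  have e1 : (u + 2 * u ^ 2).re = x + 2 * (2 * x ^ 2 - (117 / 500) ^ 2) := by
    simp [pow_two, ← hxdef, ← hydef] at *; linarith
  have e2 : (u + 2 * u ^ 2).im = y * (1 + 4 * x) := by
    simp [pow_two, ← hxdef, ← hydef]; ring
  have e3 : (u + ((7 / 10 * (117 / 500) : ℝ) : ℂ) +
      ((7 / 20 : ℝ) : ℂ) * conj u + ((0 : ℝ) : ℂ) * conj u ^ 2).re =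
      27 / 20 * x + 7 / 10 * (117 / 500) := by
    rw [ofReal_zero, zero_mul, add_zero, add_re, add_re, re_ofReal_mul, ofReal_re, conj_re]; ring
  have e4 : (u + ((7 / 10 * (117 / 500) : ℝ) : ℂ) +
      ((7 / 20 : ℝ) : ℂ) * conj u + ((0 : ℝ) : ℂ) * conj u ^ 2).im = y * (13 / 20) := by
    rw [ofReal_zero, zero_mul, add_zero, add_im, add_im, im_ofReal_mul, ofReal_im, conj_im]; ring
  have e5 : (3 * u + 4 * u ^ 2).re = 3 * x + 4 * (2 * x ^ 2 - (117 / 500) ^ 2) := by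
    simp [pow_two, ← hxdef, ← hydef] at *; linarith
  rw [e1, e2, mul_pow, hy] at hD
  rw [e3, e4, mul_pow, hy] at hV
  rw [e5]
  refine (mul_le_mul_of_nonneg_left hV zero_le_four).trans ?_
  have hp := hη1.trans hD
  clear hV hD hη1 e' e1 e2 e3 e4 e5
  generalize (η * (u + 2 * u ^ 2)).re = p at hp ⊢
  ring_nf at hp ⊢
  -- What remains is a quadratic inequality in `x = Re u`, with vertex close to `-43/500`.
  linarith [sq_nonneg (x + 43 / 500)]

theorem kernel_sections_two_of_three_le {n : ℕ} (hn : 3 ≤ n) {η : ℂ} (hη : ‖η‖ = 1) :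
    ∃ (l : ℕ) (γ : ℕ → ℂ), ∀ u : ℂ, ‖u‖ = 117 / 500 →
      ‖∑ k ∈ Finset.Icc 1 (1 : ℕ), (2 + (1 - η) * k) * u ^ k +
          ∑ j ∈ Finset.range l, γ j * conj u ^ j‖ ≤
        2 + 2 * (∑ k ∈ Finset.Icc 1 n, (2 + (1 - η) * k) * u ^ k).re - 1 / 50 := by
  refine kernel_of_pointwise (d := 7 / 10 * (117 / 500)) (c := 1 / 5) (f := 1 / 10 * (500 / 117))
    hη fun u hu => ?_
  have htail := norm_sum_Icc_two_add_mul_pow_le hη hu (by norm_num) 4 n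
  have e' : (∑ k ∈ Finset.Icc 1 n, (2 + (1 - η) * k) * u ^ k).re =
      (3 * u + 4 * u ^ 2 + 5 * u ^ 3).re - (η * (u + 2 * u ^ 2 + 3 * u ^ 3)).re +
        (∑ k ∈ Finset.Icc 4 n, (2 + (1 - η) * k) * u ^ k).re := by
    rw [sum_Icc_eq_add_sum_Icc_succ _ (by omega : 1 ≤ n),
      sum_Icc_eq_add_sum_Icc_succ _ (by omega : 1 + 1 ≤ n),
      sum_Icc_eq_add_sum_Icc_succ _ (by omega : 1 + 1 + 1 ≤ n), ← sub_re, ← add_re]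
    congr 1; push_cast; ring
  have hS := (abs_le.1 ((abs_re_le_norm _).trans htail)).1
  have hnum : 2 * ((117 / 500 : ℝ) ^ 4 * ((4 : ℕ) + 1 - (4 : ℕ) * (117 / 500)) /
    (1 - 117 / 500) ^ 2) ≤ 417 / 10000 := by norm_num
  have hη1 := re_le_norm (η * (u + 2 * u ^ 2 + 3 * u ^ 3))
  rw [norm_mul, hη, one_mul] at hη1
  have hx : u.re ^ 2 + u.im ^ 2 = (117 / 500) ^ 2 := by
    rw [← hu, ← normSq_eq_norm_sq, normSq_apply]; ring
  rw [e']
  have hD := norm_le_half_div_add (v := u + 2 * u ^ 2 + 3 * u ^ 3) (s := 1 / 5) (by norm_num)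
  have hV := norm_le_half_div_add (v := u + ((7 / 10 * (117 / 500) : ℝ) : ℂ) +
    ((1 / 5 : ℝ) : ℂ) * conj u + ((1 / 10 * (500 / 117) : ℝ) : ℂ) * conj u ^ 2)
    (s := 3 / 4 * (117 / 500)) (by norm_num)
  set S := ∑ k ∈ Finset.Icc 4 n, (2 + (1 - η) * k) * u ^ k
  set x := u.re with hxdef
  set y := u.im with hydef
  have hxl : -(117 / 500) ≤ x := by nlinarith [sq_nonneg y]
  have hxu : x ≤ 117 / 500 := by nlinarith [sq_nonneg y]
  have hy : y ^ 2 = (117 / 500) ^ 2 - x ^ 2 := by linarith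
  have hr2 : (u ^ 2).re = 2 * x ^ 2 - (117 / 500) ^ 2 := by
    rw [pow_two, mul_re, ← hxdef, ← hydef]; linarith
  have hi2 : (u ^ 2).im = 2 * x * y := by rw [pow_two, mul_im, ← hxdef, ← hydef]; ring
  have hr3 : (u ^ 3).re = 4 * x ^ 3 - 3 * (117 / 500) ^ 2 * x := by
    rw [pow_succ, mul_re, hr2, hi2, ← hxdef, ← hydef]; linear_combination (-2 * x) * hy
  have hi3 : (u ^ 3).im = y * (4 * x ^ 2 - (117 / 500) ^ 2) := by
    rw [pow_succ, mul_im, hr2, hi2, ← hxdef, ← hydef]; ring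
  have hcr : (conj u ^ 2).re = 2 * x ^ 2 - (117 / 500) ^ 2 := by rw [← map_pow, conj_re, hr2]
  have hci : (conj u ^ 2).im = -(2 * x * y) := by rw [← map_pow, conj_im, hi2]
  have hr : ∀ (a : ℝ) (v : ℂ), ((a : ℂ) * v).re = a * v.re := re_ofReal_mul
  have hi : ∀ (a : ℝ) (v : ℂ), ((a : ℂ) * v).im = a * v.im := im_ofReal_mul
  have hre : ∀ (a : ℕ) [a.AtLeastTwo] (v : ℂ),
      ((OfNat.ofNat a : ℂ) * v).re = OfNat.ofNat a * v.re := fun a _ v => by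
    rw [mul_re, re_ofNat, im_ofNat, zero_mul, sub_zero]
  have him : ∀ (a : ℕ) [a.AtLeastTwo] (v : ℂ),
      ((OfNat.ofNat a : ℂ) * v).im = OfNat.ofNat a * v.im := fun a _ v => by
    rw [mul_im, re_ofNat, im_ofNat, zero_mul, add_zero]
  have e1 : (u + 2 * u ^ 2 + 3 * u ^ 3).re = x + 2 * (2 * x ^ 2 - (117 / 500) ^ 2) +
      3 * (4 * x ^ 3 - 3 * (117 / 500) ^ 2 * x) := by
    rw [← hr2, ← hr3, add_re, add_re, hre, hre]
  have e2 : (u + 2 * u ^ 2 + 3 * u ^ 3).im =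
      y * (1 + 4 * x + 3 * (4 * x ^ 2 - (117 / 500) ^ 2)) := by
    rw [add_im, add_im, him, him, hi2, hi3]; ring
  have e3 : (u + ((7 / 10 * (117 / 500) : ℝ) : ℂ) +
      ((1 / 5 : ℝ) : ℂ) * conj u + ((1 / 10 * (500 / 117) : ℝ) : ℂ) * conj u ^ 2).re =
      6 / 5 * x + 7 / 10 * (117 / 500) +
        1 / 10 * (500 / 117) * (2 * x ^ 2 - (117 / 500) ^ 2) := by
    rw [add_re, add_re, add_re, hr, hr, ofReal_re, conj_re, hcr]; ring
  have e4 : (u + ((7 / 10 * (117 / 500) : ℝ) : ℂ) +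
      ((1 / 5 : ℝ) : ℂ) * conj u + ((1 / 10 * (500 / 117) : ℝ) : ℂ) * conj u ^ 2).im =
      y * (4 / 5 - 1 / 10 * (500 / 117) * (2 * x)) := by
    rw [add_im, add_im, add_im, hi, hi, ofReal_im, conj_im, hci]; ring
  have e5 : (3 * u + 4 * u ^ 2 + 5 * u ^ 3).re = 3 * x + 4 * (2 * x ^ 2 - (117 / 500) ^ 2) +
      5 * (4 * x ^ 3 - 3 * (117 / 500) ^ 2 * x) := by
    rw [add_re, add_re, hre, hre, hre, hr2, hr3]
  rw [e1, e2, mul_pow, hy] at hD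
  rw [e3, e4, mul_pow, hy] at hV
  rw [e5]
  refine (mul_le_mul_of_nonneg_left hV zero_le_four).trans ?_
  have hp := hη1.trans hD
  have hs := hS.trans' (neg_le_neg hnum)
  clear hV hD hη1 e' e1 e2 e3 e4 e5 hS htail hnum
  generalize (η * (u + 2 * u ^ 2 + 3 * u ^ 3)).re = p at hp ⊢
  ring_nf at hp ⊢
  -- Here the inequality is cubic in `x` on `[-r, r]`; it is certified by `(x + r)(r - x)` and `(x +
  -- r)(x + 2/25)²`.
  linarith [mul_nonneg (sub_nonneg.2 hxl) (sub_nonneg.2 hxu),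
    mul_nonneg (sub_nonneg.2 hxl) (sq_nonneg (x + 2 / 25))]

/-! ### Roots of the radius equations and conclusion -/

theorem exists_isLeast_root {f : ℝ → ℝ} (hf : Continuous f) (h0 : 0 < f 0) {b : ℝ} (hb0 : 0 < b)
    (hb1 : b < 1) (hb : f b < 0) :
    ∃ R, IsLeast {r : ℝ | 0 < r ∧ r < 1 ∧ f r = 0} R ∧ R ≤ b := by
  obtain ⟨c, hc, hfc⟩ := intermediate_value_Icc' hb0.le hf.continuousOn ⟨hb.le, h0.le⟩
  obtain ⟨R, ⟨hR, hfR⟩, hmin⟩ := (isCompact_Icc.inter_right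
    (isClosed_singleton.preimage hf) : IsCompact (Set.Icc 0 b ∩ f ⁻¹' {0})).exists_isLeast
    ⟨c, hc, hfc⟩
  have hpos : 0 < R := hR.1.lt_of_ne (by rintro rfl; exact h0.ne' hfR)
  refine ⟨R, ⟨⟨hpos, hR.2.trans_lt hb1, hfR⟩, fun r ⟨hr0, _, hfr⟩ => ?_⟩, hR.2⟩
  rcases le_total r b with h | h
  · exact hmin ⟨⟨hr0.le, h⟩, hfr⟩
  · exact hR.2.trans h

/-- The equation is affine in `β`, so it determines `1 - β` as a quotient of polynomials in `r`.
Substituting this leaves a polynomial inequality in `r` alone, `key`. -/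
theorem two_sections_radius_bound {β r : ℝ} (hr : 427 / 2000 ≤ r)
    (hr2 : r ≤ 21 / 50)
    (h : 1 - 4 * r + (6 * β - 2) * r ^ 2 - 8 * (1 - β) * r ^ 3 + (1 - 2 * β) * r ^ 4
          + 4 * (1 - β) * r ^ 5 = 0) :
    0 < 2 * β + (1 - β) * (2 - 8 * r - 2 * (r ^ 2 * (3 - 2 * r) / (1 - r) ^ 2)) := by
  have hr1 : 0 < 1 - r := by linarith
  have h1 : 0 < (1 - r) ^ 2 := by positivity
  have hr0 : 0 < r := by linarith
  have hd : 0 < r ^ 2 * (6 + 8 * r - 2 * r ^ 2 - 4 * r ^ 3) := by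
    have : 0 < 6 + 8 * r - 2 * r ^ 2 - 4 * r ^ 3 := by nlinarith [pow_pos hr0 2, pow_pos hr0 3]
    positivity
  set s := r - 427 / 2000 with hs
  have hs0 : 0 ≤ s := by linarith
  have hs1 : s ≤ 413 / 2000 := by linarith
  have key : (1 - 4 * r + 4 * r ^ 2 - r ^ 4) * (4 * r * (1 - r) ^ 2 + r ^ 2 * (3 - 2 * r)) <
      r ^ 2 * (6 + 8 * r - 2 * r ^ 2 - 4 * r ^ 3) * (1 - r) ^ 2 := by
    have : r = s + 427 / 2000 := by linarith
    rw [this]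
    nlinarith [pow_nonneg hs0 3, pow_nonneg hs0 4, mul_nonneg hs0 (sub_nonneg.2 hs1),
      mul_nonneg (mul_nonneg hs0 hs0) (sub_nonneg.2 hs1),
      mul_nonneg (pow_nonneg hs0 5) (sub_nonneg.2 hs1),
      mul_nonneg (pow_nonneg hs0 6) (sub_nonneg.2 hs1), pow_nonneg hs0 5]
  have e : (r ^ 2 * (6 + 8 * r - 2 * r ^ 2 - 4 * r ^ 3)) * (1 - β) =
      1 - 4 * r + 4 * r ^ 2 - r ^ 4 := by linear_combination -h
  have h2 : (1 - β) * (4 * r * (1 - r) ^ 2 + r ^ 2 * (3 - 2 * r)) < (1 - r) ^ 2 := by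
    rw [← mul_lt_mul_iff_right₀ hd, ← mul_assoc, e]; exact key
  have h3 : 2 * β + (1 - β) * (2 - 8 * r - 2 * (r ^ 2 * (3 - 2 * r) / (1 - r) ^ 2)) =
      2 * ((1 - r) ^ 2 - (1 - β) * (4 * r * (1 - r) ^ 2 + r ^ 2 * (3 - 2 * r))) / (1 - r) ^ 2 := by
    have := hr1.ne'
    field_simp; ring
  rw [h3]
  have := sub_pos.2 h2
  positivity

theorem mainTheorem10 (β : ℝ) (hβ0 : 0 ≤ β) (hβ1 : β < 1) :
    (∃ R₁ : ℝ,
      IsLeast {r : ℝ | 0 < r ∧ r < 1 ∧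
        1 - 4 * r + (6 * β - 2) * r ^ 2 - 8 * (1 - β) * r ^ 3 + (1 - 2 * β) * r ^ 4
          + 4 * (1 - β) * r ^ 5 = 0} R₁ ∧
      ∀ (α : ℝ), 0 ≤ α → ∀ h g : ℂ → ℂ, MemWH α β h g →
        ∀ q : ℕ, 2 < q → IsConvexInDisk (harmonicSection 2 q h g) R₁) ∧
    (∃ R₂ : ℝ,
      IsLeast {r : ℝ | 0 < r ∧ r < 1 ∧
        1 - 4 * r + (1 - β) * r ^ 2 - (8 - 3 * β) * r ^ 3 - (5 - 2 * β) * r ^ 4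
          - (4 - 3 * β) * r ^ 5 + 3 * (1 - β) * r ^ 6 = 0} R₂ ∧
      ∀ (α : ℝ), 0 ≤ α → ∀ h g : ℂ → ℂ, MemWH α β h g →
        ∀ p : ℕ, 2 < p → IsConvexInDisk (harmonicSection p 2 h g) R₂) := by
  constructor
  -- The left side is affine in `β` and negative at `21/50` for both `β = 0` and `β = 1`. For `β =
  -- 1` it is `(1 - 2r - r²)(1 - r)²`, with root `√2 - 1` just below `21/50`.
  · obtain ⟨R, hR, hRb⟩ := exists_isLeast_root (f := fun r => 1 - 4 * r + (6 * β - 2) * r ^ 2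
        - 8 * (1 - β) * r ^ 3 + (1 - 2 * β) * r ^ 4 + 4 * (1 - β) * r ^ 5) (by fun_prop)
      (by norm_num) (b := 21 / 50) (by norm_num) (by norm_num) (by norm_num; linarith)
    refine ⟨R, hR, fun α hα h g hm q hq => ?_⟩
    obtain ⟨m, rfl⟩ := Nat.exists_eq_add_of_le' (by omega : 1 ≤ q)
    rcases le_total R (427 / 2000) with hle | hge
    · exact isConvexInDisk_harmonicSection hα hβ1 hm hle (κ := 1 / 50) (by linarith)
        fun η hη => kernel_two_sections_small (by omega) hη
    · exact isConvexInDisk_harmonicSection hα hβ1 hm le_rfl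
        (two_sections_radius_bound hge hRb hR.1.2.2)
        fun η hη => kernel_two_sections_large (by omega) hR.1.2.1 hη
  -- The sextic is negative at `117/500` for every `β`, so one circle, with a margin independent of
  -- `β`, suffices.
  · obtain ⟨R, hR, hRb⟩ := exists_isLeast_root (f := fun r => 1 - 4 * r + (1 - β) * r ^ 2
        - (8 - 3 * β) * r ^ 3 - (5 - 2 * β) * r ^ 4 - (4 - 3 * β) * r ^ 5
        + 3 * (1 - β) * r ^ 6) (by fun_prop)
      (by norm_num) (b := 117 / 500) (by norm_num) (by norm_num) (by norm_num; linarith)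
    refine ⟨R, hR, fun α hα h g hm p hp => ?_⟩
    obtain ⟨n, rfl⟩ := Nat.exists_eq_add_of_le' (by omega : 1 ≤ p)
    refine isConvexInDisk_harmonicSection hα hβ1 hm hRb (κ := 1 / 50) (by linarith)
      fun η hη => ?_
    rcases (show 2 ≤ n by omega).eq_or_lt with rfl | hn
    · exact kernel_sections_two_of_eq_two hη
    · exact kernel_sections_two_of_three_le hn hη
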